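/- Setting. Let $G=(V,E,w)$ be a connected undirected graph with $n\ge 2$ nodes, indexed $1,\dots,n$, and positive integral edge weights that are polynomial in $n$: $w(e)\le n^{k}$ for a constant $k$. $\log$ is the logarithm to base 2, and $\mathrm{dist}(u,v)$ is the minimum weight of a path between $u$ and $v$. A $K$-clustering of $G$ is a partition of $V$ into $K$ clusters, each with a center contained in it; its radius is the maximum of $\mathrm{dist}(c,v)$ over all nodes $v$, with $c$ the center of the cluster of $v$. $R_G(\tau)$ is the minimum radius of a $\tau$-clustering. For a real number $\Delta$, $\ell_\Delta$ is the least integer such that any two nodes at distance at most $\Delta$ are joined by a minimum-weight path with at most $\ell_\Delta$ edges. Growing and contracting. Each node $u$ has a state $(c_u,d_u)$; a stage with set of centers $X$ starts with $(u,0)$ for $u\in X$ and $(\mathrm{nil},\infty)$ for the other nodes. In a $\Delta$-growing step, in parallel for each node $u$ with $d_u<\Delta$ and each edge $(u,v)$ of weight at most $\Delta$: if $d_u+w(u,v)\le\Delta$ and $d_v>d_u+w(u,v)$, then $(c_v,d_v)$ becomes $(c_u,d_u+w(u,v))$; among several updates of $v$ one with the smallest $d_v$ and then the smallest index $c_u$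 is performed. Contraction removes all nodes $u$ with $c_u$ defined and $c_u\ne u$, removes the edges $(u,v)$ with $c_u,c_v$ both defined, leaves those with both undefined, and replaces those with $c_u$ defined and $c_v$ undefined by $(c_u,v)$ with weight $w(u,v)$. Rescaled contraction with threshold $\Delta$ differs only in that, if $w(u,v)\le\Delta$, the new edge has weight $d_u+w(u,v)-\Delta$. CLUSTER$(G,\tau)$. Start with $\Delta=\min_e w(e)$, $C_1=\emptyset$, $G_1=G$, and write $G_i=(V_i,E_i)$. While $|V_i\setminus C_i|\ge 8\tau\log n$: select each $v\in V_i\setminus C_i$ as a new center independently with probability $(4\ln 2)\,\tau\log n/|V_i\setminus C_i|$; let $X$ be $C_i$ with the new centers, and initialize the states; perform $\Delta$-growing steps on $G_i$ until no state is updated or at least half of the nodes of $V_i\setminus C_i$ have $d_u\le\Delta$; as long as fewer than half have, double $\Delta$ and repeat the growing from the current states; then assign each $u\in V_i\setminus C_i$ with $d_u\le\Delta$ to the cluster centered at $c_u$, let $G_{i+1}$ be the contraction of $G_i$, and $C_{i+1}=X$. At the end, the remaining nodes of $V_i\setminus C_i$ become singleton clusters. CLUSTER2$(G,\tau)$. Let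 $R$ be the radius of the clustering returned by CLUSTER$(G,\tau)$; start again with $C_1=\emptyset$, $G_1=G$. For $i=1,\dots,\lceil\log n\rceil$: select each $v\in V_i\setminus C_i$ as a new center independently with probability $\min\{1,2^i/n\}$; let $X$ be $C_i$ with the new centers, and initialize the states; perform $2R$-growing steps on $G_i$ until no state is updated; assign each $u\in V_i\setminus C_i$ with $c_u$ defined to the cluster centered at $c_u$; let $G_{i+1}$ be the rescaled contraction of $G_i$ with threshold $2R$, and $C_{i+1}=X$. Lemma. For every $k$ there is a constant $C$ such that for all $n\ge2$, all $G$ as above and all integers $1\le\tau\le n$, with probability at least $1-1/n$ the algorithm CLUSTER2$(G,\tau)$ terminates and the following hold together: it computes a $K$-clustering of $G$ with $K\le C\,\tau\log^4 n$ and with radius at most $C\,R_G(\tau)\log^2 n$; it performs at most $C\,\max\{1,\ell_{R_G(\tau)\log n}\}\log n$ growing steps, those of the invocation of CLUSTER included; and each of these is a $\Delta$-growing step with $\Delta\le C\,R_G(\tau)\log n$. (The maximum with $1$ matters only for $\tau=n$, where $R_G(\tau)=0$.) -/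

import Mathlib

open scoped ENNReal

/-! ### Weighted graphs, clusterings, and the parameters `R_G(τ)` and `ℓ_Δ` -/

namespace WCluster

section Metric

variable {V : Type*} (G : SimpleGraph V) (w : Sym2 V → ℕ)

/-- The weight of a walk: the sum of the weights of its edges. -/
def walkWeight {u v : V} (p : G.Walk u v) : ℕ := (p.edges.map w).sum

/-- The distance of two nodes: the minimum weight of a walk between them. -/
noncomputable def wdist (u v : V) : ℕ :=
  sInf {x | ∃ p : G.Walk u v, walkWeight G w p = x}

/-- `ℓ_Δ`: the least `L` such that any two nodes at distance at most `Δ` are joined by a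
minimum-weight path with at most `L` edges. -/
noncomputable def ell (Δ : ℝ) : ℕ :=
  sInf {L | ∀ u v : V, (wdist G w u v : ℝ) ≤ Δ →
    ∃ p : G.Walk u v, walkWeight G w p = wdist G w u v ∧ p.length ≤ L}

variable [Fintype V]

open Classical in
/-- A clustering with exactly `k` clusters, given by the map `c` that sends each node to the
center of its cluster. The clusters are the fibres of `c` over its image, and
`c (c v) = c v` says that each center lies in its own cluster. -/
def IsClustering (k : ℕ) (c : V → V) : Prop :=
  (∀ v, c (c v) = c v) ∧ (Finset.univ.image c).card = k

/-- The radius of a clustering: the maximum distance of a node from the center of its cluster. -/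
noncomputable def radius (c : V → V) : ℕ :=
  Finset.univ.sup fun v => wdist G w (c v) v

/-- `R_G(k)`: the minimum radius of a clustering with exactly `k` clusters. -/
noncomputable def optRadius (k : ℕ) : ℕ :=
  sInf {r | ∃ c : V → V, IsClustering k c ∧ radius G w c = r}

end Metric

/-! ### Random selection -/

/-- Independent selection: the random subset of `U` that contains each element of `U`
independently with probability `min p 1`. -/
noncomputable def select {V : Type*} [DecidableEq V] (U : Finset V) (p : ℝ≥0∞) :
    PMF (Finset V) :=
  PMF.ofFinset
    (fun S => if S ⊆ U then (min p 1) ^ S.card * (1 - min p 1) ^ (U \ S).card else 0)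
    U.powerset
    (by
      have h : ∀ S ∈ U.powerset,
          (if S ⊆ U then (min p 1) ^ S.card * (1 - min p 1) ^ (U \ S).card else 0)
            = (min p 1) ^ S.card * (1 - min p 1) ^ (U.card - S.card) := by
        intro S hS
        rw [if_pos (Finset.mem_powerset.1 hS),
          Finset.card_sdiff_of_subset (Finset.mem_powerset.1 hS)]
      rw [Finset.sum_congr rfl h, Finset.sum_pow_mul_eq_add_pow,
        add_tsub_cancel_of_le (min_le_right p 1), one_pow])
    (by
      intro S hS
      rw [if_neg (fun h => hS (Finset.mem_powerset.2 h))])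

/-! ### Contracted graphs, states, and `Δ`-growing steps -/

/-- A (contracted) weighted graph on a set of nodes. `wt u v = ⊤` means that there is no edge
between `u` and `v`; of several parallel edges only the lightest is kept. -/
structure CGraph (V : Type*) where
  /-- the nodes -/
  nodes : Finset V
  /-- the edge weights -/
  wt : V → V → ℕ∞

/-- The states `(c_u, d_u)` of the nodes. `ctr u = ⊤` means that `c_u` is undefined. -/
structure GState (V : Type*) where
  /-- the center `c_u` of the cluster to which `u` is assigned -/
  ctr : V → WithTop V
  /-- the value `d_u` -/
  d : V → ℕ∞

section Growing

variable {V : Type*} [Fintype V] [LinearOrder V]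

open Classical in
/-- The input graph as a `CGraph`. -/
noncomputable def CGraph.ofGraph (G : SimpleGraph V) (w : Sym2 V → ℕ) : CGraph V where
  nodes := Finset.univ
  wt u v := if G.Adj u v then (w s(u, v) : ℕ∞) else ⊤

/-- The states at the beginning of a stage with set of centers `X`. -/
def initState (X : Finset V) : GState V where
  ctr u := if u ∈ X then (u : WithTop V) else ⊤
  d u := if u ∈ X then 0 else ⊤

open Classical in
/-- The nodes `u` that provide an update to the status of `v` in a `Δ`-growing step. -/
noncomputable def updaters (g : CGraph V) (Δ : ℕ) (s : GState V) (v : V) : Finset V :=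
  g.nodes.filter fun u =>
    s.d u < Δ ∧ g.wt u v ≤ Δ ∧ s.d u + g.wt u v ≤ Δ ∧ s.d u + g.wt u v < s.d v

open Classical in
/-- The value of `d_v` after a `Δ`-growing step. -/
noncomputable def newD (g : CGraph V) (Δ : ℕ) (s : GState V) (v : V) : ℕ∞ :=
  if (updaters g Δ s v).Nonempty then (updaters g Δ s v).inf fun u => s.d u + g.wt u v
  else s.d v

open Classical in
/-- A `Δ`-growing step. Among the possible updates to the status of `v`, one with the smallest
value of `d_v` is performed and, secondarily, one with the smallest center. -/
noncomputable def growStep (g : CGraph V) (Δ : ℕ) (s : GState V) : GState V where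
  d v := newD g Δ s v
  ctr v :=
    if (updaters g Δ s v).Nonempty then
      ((updaters g Δ s v).filter fun u => s.d u + g.wt u v = newD g Δ s v).inf s.ctr
    else s.ctr v

open Classical in
/-- The loop `repeat (Δ-growing step) until (no state is updated) or (halt)`. It returns the
final states and the number of growing steps performed, or `none` if the loop does not end
within the given number of iterations. -/
noncomputable def growUntil (g : CGraph V) (Δ : ℕ) (halt : GState V → Prop) :
    ℕ → GState V → Option (GState V × ℕ)
  | 0, _ => none
  | N + 1, s =>
    if growStep g Δ s = s ∨ halt (growStep g Δ s) then some (growStep g Δ s, 1)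
    else (growUntil g Δ halt N (growStep g Δ s)).map fun r => (r.1, r.2 + 1)

open Classical in
/-- The nodes of `U` that are reached, that is, that have `d_u ≤ Δ`. -/
noncomputable def reached (U : Finset V) (Δ : ℕ) (s : GState V) : Finset V :=
  U.filter fun u => s.d u ≤ Δ

open Classical in
/-- The nodes that survive a contraction: centers and uncovered nodes. -/
noncomputable def contractNodes (g : CGraph V) (s : GState V) : Finset V :=
  g.nodes.filter fun u => s.ctr u = u ∨ s.ctr u = ⊤

open Classical in
/-- The edge weights after a contraction in which an edge `(u, v)` with `c_u` defined and `c_v`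
undefined is replaced by an edge `(c_u, v)` of weight `f u v`. Edges with both `c_u` and `c_v`
undefined are left unchanged, and edges with both defined are removed. -/
noncomputable def contractWt (g : CGraph V) (s : GState V) (f : V → V → ℕ∞) (x y : V) : ℕ∞ :=
  if s.ctr x = ⊤ ∧ s.ctr y = ⊤ then g.wt x y
  else if s.ctr x = x ∧ s.ctr y = ⊤ then
    (g.nodes.filter fun u => s.ctr u = x).inf fun u => f u y
  else if s.ctr x = ⊤ ∧ s.ctr y = y then
    (g.nodes.filter fun u => s.ctr u = y).inf fun u => f u x
  else ⊤

/-- Procedure Contract: the edge `(c_u, v)` has the weight of `(u, v)`. -/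
noncomputable def contract (g : CGraph V) (s : GState V) : CGraph V where
  nodes := contractNodes g s
  wt := contractWt g s g.wt

open Classical in
/-- Procedure Contract2 with threshold `Δ`: a light edge `(u, v)` with `c_u` defined and `c_v`
undefined is replaced by an edge `(c_u, v)` of weight `d_u + w(u, v) - Δ`. When growth with
threshold `Δ` has come to an end, this number is positive, so that the subtraction is not
truncated. Heavy edges are treated as in Contract. -/
noncomputable def contract2 (g : CGraph V) (Δ : ℕ) (s : GState V) : CGraph V where
  nodes := contractNodes g s
  wt := contractWt g s fun u v => if g.wt u v ≤ Δ then s.d u + g.wt u v - Δ else g.wt u v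

/-! ### The algorithms

All loops are run with a budget of `N` iterations each; the value `none` says that some loop
has exhausted the budget. `trace` lists the thresholds `Δ` of all growing steps performed so
far, in order, so that its length is the number of growing steps. -/

/-- The variables of the algorithms between two stages: the current (contracted) graph, the set
of its nodes that are current cluster centers, the assignment of the original nodes to cluster
centers (`⊤` for uncovered nodes), and the list of the thresholds of the growing steps. -/
structure AState (V : Type*) where
  /-- the current graph `G_i` -/
  graph : CGraph V
  /-- the current set of centers `C_i` -/
  centers : Finset V
  /-- the center of the cluster to which a node is assigned -/
  asg : V → WithTop V
  /-- the thresholds of the growing steps performed so far -/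
  trace : List ℕ

/-- The uncovered nodes `V_i - C_i`. -/
def AState.uncovered (a : AState V) : Finset V := a.graph.nodes \ a.centers

/-- The variables at the beginning of the algorithms. -/
noncomputable def AState.init (G : SimpleGraph V) (w : Sym2 V → ℕ) : AState V where
  graph := CGraph.ofGraph G w
  centers := ∅
  asg _ := ⊤
  trace := []

open Classical in
/-- Assign each node of `S` to the cluster of its current center. -/
noncomputable def assign (asg : V → WithTop V) (S : Finset V) (s : GState V) : V → WithTop V :=
  fun u => if u ∈ S then s.ctr u else asg u

/-- Procedure PartialGrowth on a graph with set of uncovered nodes `U`: growing steps are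
performed until no state is updated or at least half of the nodes of `U` are reached. -/
noncomputable def partialGrowth (N : ℕ) (g : CGraph V) (U : Finset V) (Δ : ℕ) (s : GState V) :
    Option (GState V × ℕ) :=
  growUntil g Δ (fun s' => U.card ≤ 2 * (reached U Δ s').card) N s

/-- Procedure PartialGrowth2: growing steps are performed until no state is updated. -/
noncomputable def partialGrowth2 (N : ℕ) (g : CGraph V) (Δ : ℕ) (s : GState V) :
    Option (GState V × ℕ) :=
  growUntil g Δ (fun _ => False) N s

/-- The inner loop of CLUSTER: PartialGrowth is performed, with `Δ` doubled after each
unsuccessful attempt, until at least half of the uncovered nodes are reached. It returns the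
final states, the final value of `Δ`, and the thresholds of the growing steps performed. -/
noncomputable def innerLoop (N : ℕ) (g : CGraph V) (U : Finset V) :
    ℕ → ℕ → GState V → Option (GState V × ℕ × List ℕ)
  | 0, _, _ => none
  | M + 1, Δ, s =>
    match partialGrowth N g U Δ s with
    | none => none
    | some (s', j) =>
      if 2 * (reached U Δ s').card < U.card then
        (innerLoop N g U M (2 * Δ) s').map fun r => (r.1, r.2.1, List.replicate j Δ ++ r.2.2)
      else some (s', Δ, List.replicate j Δ)

/-- The outer loop of CLUSTER, with the current value of `Δ`. It returns the center of the
cluster of each node and the thresholds of the growing steps performed. Nodes that are uncovered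
at the end are centers of singleton clusters. -/
noncomputable def clusterLoop (N τ : ℕ) :
    ℕ → ℕ → AState V → PMF (Option ((V → V) × List ℕ))
  | 0, _, _ => PMF.pure none
  | M + 1, Δ, a =>
    open Classical in
    if 8 * (τ : ℝ) * Real.logb 2 (Fintype.card V) ≤ (a.uncovered.card : ℝ) then
      (select a.uncovered (ENNReal.ofReal
        (4 * Real.log 2 * τ * Real.logb 2 (Fintype.card V) / a.uncovered.card))).bind fun S =>
      match innerLoop N a.graph a.uncovered N Δ (initState (a.centers ∪ S)) with
      | none => PMF.pure none
      | some (s, Δ', tr) =>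
        clusterLoop N τ M Δ'
          { graph := contract a.graph s
            centers := a.centers ∪ S
            asg := assign a.asg (reached a.uncovered Δ' s) s
            trace := a.trace ++ tr }
    else PMF.pure (some (fun v => (a.asg v).untopD v, a.trace))

/-- Algorithm CLUSTER. The initial value of `Δ` is the minimum edge weight. -/
noncomputable def cluster (N : ℕ) (G : SimpleGraph V) (w : Sym2 V → ℕ) (τ : ℕ) :
    PMF (Option ((V → V) × List ℕ)) :=
  clusterLoop N τ N (sInf (w '' G.edgeSet)) (AState.init G w)

/-- Iteration `i` of the loop of CLUSTER2, with threshold `Δ`. -/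
noncomputable def cluster2Iter (N Δ i : ℕ) (a : AState V) : PMF (Option (AState V)) :=
  (select a.uncovered (2 ^ i / (Fintype.card V : ℝ≥0∞))).bind fun S =>
    match partialGrowth2 N a.graph Δ (initState (a.centers ∪ S)) with
    | none => PMF.pure none
    | some (s, j) =>
      PMF.pure (some
        { graph := contract2 a.graph Δ s
          centers := a.centers ∪ S
          asg := assign a.asg (reached a.uncovered Δ s) s
          trace := a.trace ++ List.replicate j Δ })

/-- The first `i` iterations of the loop of CLUSTER2, with threshold `Δ`. -/
noncomputable def cluster2Loop (N Δ : ℕ) (a : AState V) : ℕ → PMF (Option (AState V))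
  | 0 => PMF.pure (some a)
  | i + 1 =>
    (cluster2Loop N Δ a i).bind fun o =>
      match o with
      | none => PMF.pure none
      | some a' => cluster2Iter N Δ (i + 1) a'

/-- Algorithm CLUSTER2: CLUSTER is run, and then `⌈log₂ n⌉` iterations are performed whose
threshold is twice the radius of the clustering returned by CLUSTER. The output is the assignment
of the nodes to cluster centers, and the thresholds of all growing steps, those of the run of
CLUSTER included. -/
noncomputable def cluster2 (N : ℕ) (G : SimpleGraph V) (w : Sym2 V → ℕ) (τ : ℕ) :
    PMF (Option ((V → WithTop V) × List ℕ)) :=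
  (cluster N G w τ).bind fun o =>
    match o with
    | none => PMF.pure none
    | some (c, tr) =>
      (cluster2Loop N (2 * radius G w c) { AState.init G w with trace := tr }
        (Nat.clog 2 (Fintype.card V))).map (Option.map fun a => (a.asg, a.trace))

/-- The probability that CLUSTER2 terminates with an output that satisfies `P`. With budget `N`,
a run gives `none` or else the output of the run without budget, so that the probabilities
increase with `N` to this number. -/
noncomputable def cluster2Prob (G : SimpleGraph V) (w : Sym2 V → ℕ) (τ : ℕ)
    (P : (V → WithTop V) → List ℕ → Prop) : ℝ≥0∞ :=
  ⨆ N : ℕ, (cluster2 N G w τ).toOuterMeasure {o | ∃ asg tr, o = some (asg, tr) ∧ P asg tr}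

end Growing

end WCluster

set_option linter.unusedSectionVars false

/-! Contraction leaves the edges between uncovered nodes intact, so growing can be measured by
distances in the input graph. For the contracted edges two one-sided facts suffice (`AState.Inv`).
Every edge of `G` from a covered to an uncovered node is matched by a contracted edge that is no
heavier; and a contracted edge underestimates the distance from its center by at most the current
radius bound `ρ`. By the first fact an optimal route from the centers never passes through a covered
node again, so it is at most one contracted edge followed by a minimum-weight path of `G`. Hence one
growing step plus `ell` many settle all values up to `Δ` (`Reachable.iterate_d_le`), and at the end
every uncovered node within distance `Δ` of a new center is reached (`Reachable.d_le_of_stable`). By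
the second fact a stage raises the radius bound by at most `Δ` (`AState.Inv.nextState`).

Randomness enters through a Chernoff bound and `select_hit_le`: if a fixed clustering has at most
`W` clusters and about `2 W x` nodes are selected on average, then, except with probability `W
e^{-x}`, the clusters that are hit contain half of the uncovered nodes, all within twice the radius
of a selected node. For CLUSTER the fixed clustering is an optimal one, of radius `R`: each stage
halves the uncovered set with a threshold of at most `4 R`, so that `O(τ log² n)` clusters of radius
`R' = O(R log n)` result. For CLUSTER2 it is the output of CLUSTER, with `W` clusters: threshold `2
R'` covers half of the uncovered nodes whenever `|U| 2^i` would exceed `16 n W ln n`. So each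
iteration selects `O(W log n)` centers and adds `2 R'` to the radius, and the last one selects every
node that is left.

All thresholds are at most some `B = O(R log n)`, and a growing phase takes at most `ell B + 2`
steps. There is one phase per stage and one per doubling; the doublings number `O(log n)` because
the weights are polynomial. Finally `ell_mul_le` removes the constant factor from `B`. -/

namespace WCluster

/-! ### Distances and edge counts of minimum-weight paths. -/

section Metric

variable {V : Type*} {G : SimpleGraph V} {w : Sym2 V → ℕ}

@[simp] lemma walkWeight_nil {u : V} : walkWeight G w (SimpleGraph.Walk.nil : G.Walk u u) = 0 := by
  simp [walkWeight]

@[simp] lemma walkWeight_cons {u v x : V} (h : G.Adj u v) (p : G.Walk v x) :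
    walkWeight G w (SimpleGraph.Walk.cons h p) = w s(u, v) + walkWeight G w p := by
  simp [walkWeight]

@[simp] lemma walkWeight_append {u v x : V} (p : G.Walk u v) (q : G.Walk v x) :
    walkWeight G w (p.append q) = walkWeight G w p + walkWeight G w q := by
  simp [walkWeight]

@[simp] lemma walkWeight_reverse {u v : V} (p : G.Walk u v) :
    walkWeight G w p.reverse = walkWeight G w p := by
  simp [walkWeight, List.sum_reverse]

lemma wdist_le_walkWeight {u v : V} (p : G.Walk u v) : wdist G w u v ≤ walkWeight G w p :=
  Nat.sInf_le ⟨p, rfl⟩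

lemma exists_walk_wdist (hG : G.Connected) (u v : V) :
    ∃ p : G.Walk u v, walkWeight G w p = wdist G w u v := by
  obtain ⟨p⟩ := hG.preconnected u v
  exact Nat.sInf_mem (s := {x | ∃ p : G.Walk u v, walkWeight G w p = x}) ⟨_, p, rfl⟩

@[simp] lemma wdist_self (u : V) : wdist G w u u = 0 :=
  Nat.le_zero.1 ((wdist_le_walkWeight SimpleGraph.Walk.nil).trans_eq walkWeight_nil)

lemma wdist_comm (hG : G.Connected) (u v : V) : wdist G w u v = wdist G w v u := by
  apply le_antisymm
  · obtain ⟨p, hp⟩ := exists_walk_wdist (w := w) hG v u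
    simpa [hp] using wdist_le_walkWeight (w := w) p.reverse
  · obtain ⟨p, hp⟩ := exists_walk_wdist (w := w) hG u v
    simpa [hp] using wdist_le_walkWeight (w := w) p.reverse

lemma wdist_triangle (hG : G.Connected) (u v x : V) :
    wdist G w u x ≤ wdist G w u v + wdist G w v x := by
  obtain ⟨p, hp⟩ := exists_walk_wdist (w := w) hG u v
  obtain ⟨q, hq⟩ := exists_walk_wdist (w := w) hG v x
  simpa [hp, hq] using wdist_le_walkWeight (w := w) (p.append q)

lemma wdist_le_of_adj {u v : V} (h : G.Adj u v) : wdist G w u v ≤ w s(u, v) := by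
  simpa using wdist_le_walkWeight (w := w) (SimpleGraph.Walk.cons h SimpleGraph.Walk.nil)

lemma le_walkWeight_of_ne {m : ℕ} (hw : ∀ e ∈ G.edgeSet, m ≤ w e) {u v : V} (huv : u ≠ v)
    (p : G.Walk u v) : m ≤ walkWeight G w p := by
  cases p with
  | nil => exact absurd rfl huv
  | cons h q =>
    rw [walkWeight_cons]
    exact (hw _ h).trans (Nat.le_add_right _ _)

lemma le_wdist_of_ne (hG : G.Connected) {m : ℕ} (hw : ∀ e ∈ G.edgeSet, m ≤ w e) {u v : V}
    (huv : u ≠ v) : m ≤ wdist G w u v := by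
  obtain ⟨p, hp⟩ := exists_walk_wdist (w := w) hG u v
  exact hp ▸ le_walkWeight_of_ne hw huv p

lemma walkWeight_le {m : ℕ} (hw : ∀ e ∈ G.edgeSet, w e ≤ m) {u v : V} (p : G.Walk u v) :
    walkWeight G w p ≤ p.length * m := by
  induction p with
  | nil => simp
  | cons h q ih =>
    rw [walkWeight_cons, SimpleGraph.Walk.length_cons, add_mul, one_mul, add_comm]
    exact add_le_add ih (hw _ h)

lemma wdist_le_card_mul [Fintype V] (hG : G.Connected) {m : ℕ} (hw : ∀ e ∈ G.edgeSet, w e ≤ m)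
    (u v : V) : wdist G w u v ≤ Fintype.card V * m := by
  classical
  obtain ⟨p⟩ := hG.preconnected u v
  exact (wdist_le_walkWeight p.toPath.1).trans ((walkWeight_le hw _).trans
    (Nat.mul_le_mul_right _ p.toPath.2.length_lt.le))

lemma ell_spec [Finite V] (hG : G.Connected) {Δ : ℝ} {u v : V} (h : (wdist G w u v : ℝ) ≤ Δ) :
    ∃ p : G.Walk u v, walkWeight G w p = wdist G w u v ∧ p.length ≤ ell G w Δ := by
  have hne : {L | ∀ u v : V, (wdist G w u v : ℝ) ≤ Δ →
      ∃ p : G.Walk u v, walkWeight G w p = wdist G w u v ∧ p.length ≤ L}.Nonempty := by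
    choose p hp using fun x : V × V => exists_walk_wdist (w := w) hG x.1 x.2
    obtain ⟨L, hL⟩ := (Set.finite_range fun x => (p x).length).bddAbove
    exact ⟨L, fun a b _ => ⟨p (a, b), hp (a, b), hL ⟨(a, b), rfl⟩⟩⟩
  exact Nat.sInf_mem hne u v h

lemma ell_le {Δ : ℝ} {L : ℕ} (h : ∀ u v : V, (wdist G w u v : ℝ) ≤ Δ →
    ∃ p : G.Walk u v, walkWeight G w p = wdist G w u v ∧ p.length ≤ L) : ell G w Δ ≤ L :=
  Nat.sInf_le h

lemma ell_mono [Finite V] (hG : G.Connected) {Δ Δ' : ℝ} (h : Δ ≤ Δ') :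
    ell G w Δ ≤ ell G w Δ' :=
  ell_le fun _ _ huv => ell_spec hG (huv.trans h)

/-- The first edge of a minimum-weight path that leaves the ball of radius `Δ`. -/
lemma exists_crossing_edge (hG : G.Connected) {Δ : ℝ} {u x v : V} (p : G.Walk x v)
    (hp : wdist G w u v = wdist G w u x + walkWeight G w p) (hx : (wdist G w u x : ℝ) ≤ Δ)
    (hv : Δ < wdist G w u v) :
    ∃ a b, G.Adj a b ∧ (wdist G w u a : ℝ) ≤ Δ ∧ Δ < wdist G w u a + w s(a, b) ∧
      wdist G w u v = wdist G w u a + w s(a, b) + wdist G w b v := by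
  induction p with
  | nil => exact absurd (hv.trans_le hx) (lt_irrefl _)
  | @cons x b v h q ih =>
    rw [walkWeight_cons] at hp
    -- Together these four inequalities force equality everywhere: `b` and the rest `q` of the walk
    -- again lie on a minimum-weight route from `u`.
    have h1 := wdist_triangle (w := w) hG u b v
    have h2 := wdist_triangle (w := w) hG u x b
    have h3 := wdist_le_of_adj (w := w) h
    have h4 := wdist_le_walkWeight (w := w) q
    by_cases hb : (wdist G w u b : ℝ) ≤ Δ
    · exact ih (by omega) hb hv
    · refine ⟨x, b, h, hx, ?_, by omega⟩
      rw [not_le] at hb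
      refine hb.trans_le ?_
      exact_mod_cast (by omega : wdist G w u b ≤ wdist G w u x + w s(x, b))

/-- A minimum-weight path is cut at the first edge that leaves the ball of radius `Δ`. The part
before it can be chosen with `ell Δ` edges, the edge itself adds one, and beyond it less than `Δ`
times the remaining multiple is left. -/
lemma ell_mul_le [Finite V] (hG : G.Connected) (hw : ∀ e ∈ G.edgeSet, 1 ≤ w e) {Δ : ℝ} (hΔ : 0 ≤ Δ) (m : ℕ) :
    ell G w (m * Δ) ≤ m * (ell G w Δ + 1) := by
  refine ell_le fun u v => ?_
  induction m generalizing u with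
  | zero =>
    intro h
    have h0 : wdist G w u v = 0 := by simpa using h
    obtain rfl : u = v := by
      by_contra huv
      have := le_wdist_of_ne hG hw huv
      omega
    exact ⟨SimpleGraph.Walk.nil, by simp, by simp⟩
  | succ m ih =>
    intro h
    by_cases hle : (wdist G w u v : ℝ) ≤ Δ
    · obtain ⟨p, hp, hl⟩ := ell_spec hG hle
      exact ⟨p, hp, hl.trans (by nlinarith [Nat.zero_le (m * (ell G w Δ + 1))])⟩
    · obtain ⟨p, hp⟩ := exists_walk_wdist (w := w) hG u v
      obtain ⟨a, b, hab, ha, hΔ', heq⟩ := exists_crossing_edge hG (u := u) p (by simp [hp])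
        (by simpa using hΔ) (not_le.1 hle)
      have heq' : (wdist G w u v : ℝ) = wdist G w u a + w s(a, b) + wdist G w b v := by
        exact_mod_cast heq
      obtain ⟨q, hq, hql⟩ := ih b (by push_cast at h; linarith)
      obtain ⟨r, hr, hrl⟩ := ell_spec hG ha
      refine ⟨r.append (SimpleGraph.Walk.cons hab q), by simp [hq, hr, heq]; ring, ?_⟩
      rw [SimpleGraph.Walk.length_append, SimpleGraph.Walk.length_cons]
      linarith

end Metric

/-! ### Growing steps and contraction, compared with distances in the input graph. -/

section Growing

variable {V : Type*} [Fintype V] [LinearOrder V] {G : SimpleGraph V} {w : Sym2 V → ℕ}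

/-- The invariant of both algorithms between two stages: each covered node is at distance at most
`ρ` from the center of its cluster, and the current graph is the contraction of the input graph
along the clusters, up to a rescaling of the edges between covered and uncovered nodes. -/
structure AState.Inv (G : SimpleGraph V) (w : Sym2 V → ℕ) (ρ : ℕ) (a : AState V) : Prop where
  centers_subset : a.centers ⊆ a.graph.nodes
  asg_uncovered : ∀ v ∈ a.uncovered, a.asg v = ⊤
  asg_covered : ∀ v ∉ a.uncovered, ∃ x ∈ a.centers, a.asg v = x ∧ wdist G w x v ≤ ρ
  asg_center : ∀ x ∈ a.centers, a.asg x = x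
  wt_uncovered : ∀ u ∈ a.uncovered, ∀ v ∈ a.uncovered,
    a.graph.wt u v = (CGraph.ofGraph G w).wt u v
  wt_covered : ∀ y ∉ a.uncovered, ∀ v ∈ a.uncovered, G.Adj y v →
    ∃ c ∈ a.centers, a.graph.wt c v ≤ w s(y, v)
  wt_ne_zero : ∀ c ∈ a.centers, ∀ v ∈ a.uncovered, a.graph.wt c v ≠ 0
  wdist_le : ∀ c ∈ a.centers, ∀ v ∈ a.uncovered, (wdist G w c v : ℕ∞) ≤ ρ + a.graph.wt c v
  wt_of_notMem : ∀ u, ∀ v ∉ a.graph.nodes, a.graph.wt u v = ⊤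

lemma AState.mem_uncovered {a : AState V} {v : V} :
    v ∈ a.uncovered ↔ v ∈ a.graph.nodes ∧ v ∉ a.centers := Finset.mem_sdiff

lemma ofGraph_wt_of_adj {u v : V} (h : G.Adj u v) :
    (CGraph.ofGraph G w).wt u v = w s(u, v) := if_pos h

lemma ofGraph_wt_of_not_adj {u v : V} (h : ¬ G.Adj u v) :
    (CGraph.ofGraph G w).wt u v = ⊤ := if_neg h

@[simp] lemma uncovered_init (tr : List ℕ) :
    AState.uncovered { AState.init G w with trace := tr } = Finset.univ := by
  simp [AState.uncovered, AState.init, CGraph.ofGraph]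

lemma AState.Inv.init (tr : List ℕ) :
    AState.Inv G w 0 { AState.init G w with trace := tr } where
  centers_subset := by simp [AState.init]
  asg_uncovered _ _ := rfl
  asg_covered v hv := by simp at hv
  asg_center x hx := by simp [AState.init] at hx
  wt_uncovered _ _ _ _ := rfl
  wt_covered y hy := by simp at hy
  wt_ne_zero c hc := by simp [AState.init] at hc
  wdist_le c hc := by simp [AState.init] at hc
  wt_of_notMem u v hv := by simp [AState.init, CGraph.ofGraph] at hv

/-- The cost of entering the uncovered part of the current graph at `z`. -/
noncomputable def entryCost (a : AState V) (S : Finset V) (z : V) : ℕ∞ :=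
  if z ∈ S then 0 else a.centers.inf fun c => a.graph.wt c z

/-- The distance of `v` from the centers in the current graph. -/
noncomputable def centerDist (G : SimpleGraph V) (w : Sym2 V → ℕ) (a : AState V) (S : Finset V)
    (v : V) : ℕ∞ :=
  if v ∈ a.centers then 0 else a.uncovered.inf fun z => entryCost a S z + wdist G w z v

/-- The states that may occur while clusters are grown with threshold `Δ` from the centers of `a`
and the new centers `S`. -/
structure Reachable (G : SimpleGraph V) (w : Sym2 V → ℕ) (ρ : ℕ) (a : AState V) (S : Finset V)
    (Δ : ℕ) (s : GState V) : Prop where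
  center : ∀ x ∈ a.centers ∪ S, s.d x = 0 ∧ s.ctr x = x
  sound : ∀ v, s.d v ≠ ⊤ → s.d v ≤ Δ ∧ v ∈ a.graph.nodes ∧
    ∃ x ∈ a.centers ∪ S, s.ctr v = x ∧ (wdist G w x v : ℕ∞) ≤ ρ + s.d v
  ctr_of_top : ∀ v, s.d v = ⊤ → s.ctr v = ⊤
  centerDist_le : ∀ v, centerDist G w a S v ≤ s.d v

variable {ρ Δ : ℕ} {a : AState V} {S : Finset V} {s : GState V}

lemma AState.mem_nodes_of_mem_uncovered {v : V} (h : v ∈ a.uncovered) : v ∈ a.graph.nodes :=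
  (AState.mem_uncovered.1 h).1

lemma AState.Inv.mem_nodes_of_mem_union (ha : a.Inv G w ρ) (hS : S ⊆ a.uncovered) {x : V}
    (hx : x ∈ a.centers ∪ S) : x ∈ a.graph.nodes := by
  rcases Finset.mem_union.1 hx with h | h
  · exact ha.centers_subset h
  · exact AState.mem_nodes_of_mem_uncovered (hS h)

lemma entryCost_of_mem {z : V} (hz : z ∈ S) : entryCost a S z = 0 := if_pos hz

lemma entryCost_le {z c : V} (hc : c ∈ a.centers) : entryCost a S z ≤ a.graph.wt c z := by
  unfold entryCost
  split_ifs
  · exact zero_le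
  · exact Finset.inf_le hc

lemma centerDist_le_add {z v : V} (hz : z ∈ a.uncovered) :
    centerDist G w a S v ≤ entryCost a S z + wdist G w z v := by
  unfold centerDist
  split_ifs
  · exact zero_le
  · exact Finset.inf_le (f := fun z => entryCost a S z + (wdist G w z v : ℕ∞)) hz

lemma exists_centerDist_eq {v : V} (hv : v ∈ a.uncovered) :
    ∃ z ∈ a.uncovered, centerDist G w a S v = entryCost a S z + wdist G w z v := by
  rw [centerDist, if_neg (AState.mem_uncovered.1 hv).2]
  exact Finset.exists_mem_eq_inf _ ⟨v, hv⟩ _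

lemma Reachable.initState (ha : a.Inv G w ρ) (hS : S ⊆ a.uncovered) :
    Reachable G w ρ a S Δ (initState (a.centers ∪ S)) where
  center x hx := by simp only [WCluster.initState, if_pos hx, and_self]
  sound v hv := by
    have hvX : v ∈ a.centers ∪ S := by
      by_contra h
      simp only [WCluster.initState, if_neg h, ne_eq, not_true_eq_false] at hv
    refine ⟨by simp only [WCluster.initState, if_pos hvX, zero_le],
      ha.mem_nodes_of_mem_union hS hvX, v, hvX, ?_, by simp⟩
    simp only [WCluster.initState, if_pos hvX]
  ctr_of_top v hv := by
    by_cases h : v ∈ a.centers ∪ S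
    · simp only [WCluster.initState, if_pos h, ENat.zero_ne_top] at hv
    · simp only [WCluster.initState, if_neg h]
  centerDist_le v := by
    by_cases h : v ∈ a.centers ∪ S
    · simp only [WCluster.initState, if_pos h]
      rcases Finset.mem_union.1 h with h | h
      · rw [centerDist, if_pos h]
      · refine (centerDist_le_add (hS h)).trans ?_
        simp [entryCost_of_mem h]
    · simp only [WCluster.initState, if_neg h, le_top]

lemma Reachable.mono {Δ' : ℕ} (h : Reachable G w ρ a S Δ s) (hΔ : Δ ≤ Δ') :
    Reachable G w ρ a S Δ' s where
  center := h.center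
  sound v hv := ⟨(h.sound v hv).1.trans (by exact_mod_cast hΔ), (h.sound v hv).2⟩
  ctr_of_top := h.ctr_of_top
  centerDist_le := h.centerDist_le

/-- This makes `centerDist` a lower bound for all values that growing can produce, and later shows
that no update is possible once the bound is attained. -/
lemma centerDist_le_add_wt (hG : G.Connected) (ha : a.Inv G w ρ) {u v : V}
    (hu : u ∈ a.graph.nodes) :
    centerDist G w a S v ≤ centerDist G w a S u + a.graph.wt u v := by
  by_cases hv : v ∈ a.graph.nodes
  swap
  · rw [ha.wt_of_notMem u v hv, add_top]
    exact le_top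
  by_cases hvC : v ∈ a.centers
  · rw [centerDist, if_pos hvC]
    exact zero_le
  have hvU : v ∈ a.uncovered := AState.mem_uncovered.2 ⟨hv, hvC⟩
  by_cases huC : u ∈ a.centers
  · refine (centerDist_le_add hvU).trans ?_
    simpa using (entryCost_le huC).trans le_add_self
  have huU : u ∈ a.uncovered := AState.mem_uncovered.2 ⟨hu, huC⟩
  obtain ⟨z, hz, hzu⟩ := exists_centerDist_eq (G := G) (w := w) (S := S) huU
  refine (centerDist_le_add hz).trans ?_
  rw [hzu, ha.wt_uncovered u huU v hvU, add_assoc]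
  gcongr
  by_cases hadj : G.Adj u v
  · rw [ofGraph_wt_of_adj hadj]
    exact_mod_cast (wdist_triangle hG z u v).trans
      (Nat.add_le_add_left (wdist_le_of_adj hadj) _)
  · rw [ofGraph_wt_of_not_adj hadj, add_top]
    exact le_top

lemma mem_updaters {g : CGraph V} {u v : V} : u ∈ updaters g Δ s v ↔
    u ∈ g.nodes ∧ s.d u < Δ ∧ g.wt u v ≤ Δ ∧ s.d u + g.wt u v ≤ Δ ∧
      s.d u + g.wt u v < s.d v := by
  simp [updaters]

/-- Either the state of `v` is not updated, or the values of the update come from some node. -/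
lemma growStep_cases (g : CGraph V) (Δ : ℕ) (s : GState V) (v : V) :
    ((growStep g Δ s).d v = s.d v ∧ (growStep g Δ s).ctr v = s.ctr v ∧
      updaters g Δ s v = ∅) ∨
    ∃ u ∈ updaters g Δ s v, (growStep g Δ s).d v = s.d u + g.wt u v ∧
      (growStep g Δ s).ctr v = s.ctr u := by
  classical
  by_cases h : (updaters g Δ s v).Nonempty
  · right
    obtain ⟨u, hu, hud⟩ := Finset.exists_mem_eq_inf _ h fun u => s.d u + g.wt u v
    have hnew : newD g Δ s v = s.d u + g.wt u v := by rw [newD, if_pos h, hud]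
    have hne : ((updaters g Δ s v).filter
        fun u => s.d u + g.wt u v = newD g Δ s v).Nonempty :=
      ⟨u, Finset.mem_filter.2 ⟨hu, hnew.symm⟩⟩
    obtain ⟨u', hu', huc⟩ := Finset.exists_mem_eq_inf _ hne s.ctr
    rw [Finset.mem_filter] at hu'
    refine ⟨u', hu'.1, hu'.2.symm, ?_⟩
    simp only [growStep, if_pos h]
    convert huc
  · left
    refine ⟨by simp only [growStep, newD, if_neg h], by simp only [growStep, if_neg h],
      Finset.not_nonempty_iff_eq_empty.1 h⟩

lemma growStep_d_le (g : CGraph V) (Δ : ℕ) (s : GState V) (v : V) :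
    (growStep g Δ s).d v ≤ s.d v := by
  rcases growStep_cases g Δ s v with ⟨h, -⟩ | ⟨u, hu, h, -⟩
  · exact h.le
  · rw [h]
    exact (mem_updaters.1 hu).2.2.2.2.le

/-- A positive weight makes the tests on `d_u` and on the edge weight follow from the test on their
sum. This is why the invariant demands that contracted edges have nonzero weight. -/
lemma growStep_d_le_of_wt {g : CGraph V} {u v : V} {x : ℕ∞} (hu : u ∈ g.nodes)
    (hwt : g.wt u v ≠ 0) (hx : s.d u ≤ x) (hΔ : x + g.wt u v ≤ Δ) :
    (growStep g Δ s).d v ≤ x + g.wt u v := by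
  by_cases hlt : s.d u + g.wt u v < s.d v
  · have h1 : s.d u + g.wt u v ≤ Δ := (by gcongr : _ ≤ x + g.wt u v).trans hΔ
    have h2 : s.d u ≠ ⊤ := fun h => by simp [h] at hlt
    have h3 : s.d u < s.d u + g.wt u v := by
      simpa using (ENat.add_lt_add_iff_left h2).2 (pos_iff_ne_zero.2 hwt)
    have hmem : u ∈ updaters g Δ s v := mem_updaters.2
      ⟨hu, h3.trans_le h1, le_add_self.trans h1, h1, hlt⟩
    have : (growStep g Δ s).d v = (updaters g Δ s v).inf fun u => s.d u + g.wt u v :=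
      if_pos ⟨u, hmem⟩
    rw [this]
    exact (Finset.inf_le (f := fun u => s.d u + g.wt u v) hmem).trans (by gcongr)
  · exact (growStep_d_le g Δ s v).trans ((not_lt.1 hlt).trans (by gcongr))

/-- Old centers keep the value 0, so a contracted edge can only be the first edge of a chain of
updates. The error `ρ` is therefore incurred at most once; every further edge is an edge of `G`. -/
lemma Reachable.growStep (hG : G.Connected) (ha : a.Inv G w ρ)
    (hs : Reachable G w ρ a S Δ s) : Reachable G w ρ a S Δ (growStep a.graph Δ s) where
  center x hx := by
    obtain ⟨hd, hc⟩ := hs.center x hx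
    rcases growStep_cases a.graph Δ s x with ⟨h, h', -⟩ | ⟨u, hu, -⟩
    · exact ⟨h.trans hd, h'.trans hc⟩
    · have := (mem_updaters.1 hu).2.2.2.2
      simp [hd] at this
  sound v hv := by
    rcases growStep_cases a.graph Δ s v with ⟨h, h', -⟩ | ⟨u, hu, h, h'⟩
    · rw [h, h']
      exact hs.sound v (h ▸ hv)
    · obtain ⟨hun, hud, -, hle, hlt⟩ := mem_updaters.1 hu
      have hvn : v ∈ a.graph.nodes := by
        by_contra hvn
        rw [ha.wt_of_notMem u v hvn, add_top] at hlt
        exact not_top_lt hlt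
      have hvC : v ∉ a.centers := fun hvC => by
        rw [(hs.center v (Finset.mem_union_left _ hvC)).1] at hlt
        exact not_lt_zero hlt
      have hvU : v ∈ a.uncovered := AState.mem_uncovered.2 ⟨hvn, hvC⟩
      rw [h, h']
      refine ⟨hle, hvn, ?_⟩
      by_cases huC : u ∈ a.centers
      · obtain ⟨hd, hc⟩ := hs.center u (Finset.mem_union_left _ huC)
        exact ⟨u, Finset.mem_union_left _ huC, hc, by
          rw [hd, zero_add]
          exact ha.wdist_le u huC v hvU⟩
      have huU : u ∈ a.uncovered := AState.mem_uncovered.2 ⟨hun, huC⟩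
      obtain ⟨-, -, x, hx, hcx, hxu⟩ := hs.sound u (ne_top_of_lt hud)
      refine ⟨x, hx, hcx, ?_⟩
      rw [ha.wt_uncovered u huU v hvU] at hle ⊢
      by_cases hadj : G.Adj u v
      · rw [ofGraph_wt_of_adj hadj, ← add_assoc]
        calc (wdist G w x v : ℕ∞) ≤ wdist G w x u + w s(u, v) := by
              exact_mod_cast (wdist_triangle hG x u v).trans
                (Nat.add_le_add_left (wdist_le_of_adj hadj) _)
          _ ≤ _ := by gcongr
      · rw [ofGraph_wt_of_not_adj hadj, add_top, add_top]
        exact le_top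
  ctr_of_top v hv := by
    rcases growStep_cases a.graph Δ s v with ⟨h, h', -⟩ | ⟨u, hu, h, -⟩
    · rw [h']
      exact hs.ctr_of_top v (h ▸ hv)
    · have := (mem_updaters.1 hu).2.2.2.2
      rw [← h, hv] at this
      exact absurd this not_top_lt
  centerDist_le v := by
    rcases growStep_cases a.graph Δ s v with ⟨h, -⟩ | ⟨u, hu, h, -⟩
    · rw [h]
      exact hs.centerDist_le v
    · rw [h]
      refine (centerDist_le_add_wt hG ha (mem_updaters.1 hu).1).trans ?_
      gcongr
      exact hs.centerDist_le u

lemma Reachable.iterate (hG : G.Connected) (ha : a.Inv G w ρ)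
    (hs : Reachable G w ρ a S Δ s) (n : ℕ) :
    Reachable G w ρ a S Δ ((WCluster.growStep a.graph Δ)^[n] s) := by
  induction n generalizing s with
  | zero => exact hs
  | succ n ih => exact ih (hs.growStep hG ha)

lemma iterate_growStep_d_le (g : CGraph V) (Δ n : ℕ) (s : GState V) (v : V) :
    ((growStep g Δ)^[n] s).d v ≤ s.d v := by
  induction n generalizing s with
  | zero => exact le_rfl
  | succ n ih => exact (ih _).trans (growStep_d_le g Δ s v)

/-- A walk within the uncovered nodes is followed by as many growing steps as it has edges. -/
lemma iterate_growStep_d_le_walk (hw : ∀ e ∈ G.edgeSet, 1 ≤ w e) (ha : a.Inv G w ρ) {z v : V}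
    (p : G.Walk z v) (hp : ∀ y ∈ p.support, y ∈ a.uncovered) {x : ℕ∞} (hx : s.d z ≤ x)
    (hΔ : x + walkWeight G w p ≤ Δ) :
    ((growStep a.graph Δ)^[p.length] s).d v ≤ x + walkWeight G w p := by
  induction p generalizing s x with
  | nil => simpa using hx
  | @cons z b v h q ih =>
    have hb : a.graph.wt z b = w s(z, b) := by
      rw [ha.wt_uncovered z (hp z (by simp)) b (hp b (by simp)), ofGraph_wt_of_adj h]
    rw [walkWeight_cons, Nat.cast_add, ← add_assoc] at hΔ ⊢
    rw [SimpleGraph.Walk.length_cons, Function.iterate_succ_apply]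
    refine ih (fun y hy => hp y (by simp [hy])) ?_ hΔ
    rw [← hb] at hΔ ⊢
    refine growStep_d_le_of_wt (AState.mem_nodes_of_mem_uncovered (hp z (by simp))) ?_ hx
      (le_self_add.trans hΔ)
    have := hw s(z, b) h
    rw [hb]
    exact_mod_cast (by omega : w s(z, b) ≠ 0)

/-- A walk from a covered to an uncovered node enters the uncovered part for the last time. -/
lemma exists_entry (ha : a.Inv G w ρ) {y v : V} (q : G.Walk y v) (hy : y ∉ a.uncovered)
    (hv : v ∈ a.uncovered) :
    ∃ b ∈ a.uncovered, entryCost a S b + wdist G w b v ≤ walkWeight G w q := by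
  induction q with
  | nil => exact absurd hv hy
  | @cons y b v h q ih =>
    by_cases hb : b ∈ a.uncovered
    · obtain ⟨c, hc, hcb⟩ := ha.wt_covered y hy b hb h
      refine ⟨b, hb, ?_⟩
      rw [walkWeight_cons, Nat.cast_add]
      gcongr
      · exact (entryCost_le hc).trans hcb
      · exact wdist_le_walkWeight q
    · obtain ⟨b', hb', hle⟩ := ih hb hv
      refine ⟨b', hb', hle.trans ?_⟩
      exact_mod_cast (walkWeight_cons h q).symm ▸ Nat.le_add_left _ _

/-- A covered node on the path would allow entering the uncovered part after it, at a total cost of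
at most the weight of the rest of the path. The part before it has positive weight, which
contradicts the choice of `z`. -/
lemma support_subset_uncovered (hw : ∀ e ∈ G.edgeSet, 1 ≤ w e) (ha : a.Inv G w ρ) {z v : V}
    (hz : z ∈ a.uncovered) (hv : v ∈ a.uncovered) (p : G.Walk z v)
    (hp : walkWeight G w p = wdist G w z v) 
    (hD : centerDist G w a S v = entryCost a S z + wdist G w z v) :
    ∀ y ∈ p.support, y ∈ a.uncovered := by
  classical
  intro y hy
  by_contra hyU
  obtain ⟨b, hb, hle⟩ := exists_entry (S := S) ha (p.dropUntil y hy) hyU hv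
  have hsplit : walkWeight G w (p.takeUntil y hy) + walkWeight G w (p.dropUntil y hy)
      = walkWeight G w p := by
    rw [← walkWeight_append, SimpleGraph.Walk.take_spec]
  have hpos : 1 ≤ walkWeight G w (p.takeUntil y hy) :=
    le_walkWeight_of_ne hw (by rintro rfl; exact hyU hz) _
  have h1 : (wdist G w z v : ℕ∞) ≤ walkWeight G w (p.dropUntil y hy) :=
    le_add_self.trans ((hD.symm.le.trans (centerDist_le_add hb)).trans hle)
  have h2 : wdist G w z v ≤ walkWeight G w (p.dropUntil y hy) := by exact_mod_cast h1
  omega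

/-- After `ℓ_Δ + 1` growing steps, all nodes at distance at most `Δ` from the centers have their
final values. -/
lemma Reachable.iterate_d_le (hG : G.Connected) (hw : ∀ e ∈ G.edgeSet, 1 ≤ w e)
    (ha : a.Inv G w ρ) (hs : Reachable G w ρ a S Δ s) {v : V}
    (hvn : v ∈ a.graph.nodes) (hv : centerDist G w a S v ≤ Δ) :
    ((WCluster.growStep a.graph Δ)^[ell G w Δ + 1] s).d v ≤ centerDist G w a S v := by
  by_cases hvC : v ∈ a.centers
  · rw [((hs.iterate hG ha _).center v (Finset.mem_union_left _ hvC)).1]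
    exact zero_le
  have hvU : v ∈ a.uncovered := AState.mem_uncovered.2 ⟨hvn, hvC⟩
  obtain ⟨z, hz, hzv⟩ := exists_centerDist_eq (G := G) (w := w) (S := S) hvU
  rw [hzv] at hv ⊢
  have hdist : wdist G w z v ≤ Δ := by exact_mod_cast le_add_self.trans hv
  obtain ⟨p, hp, hl⟩ := ell_spec (w := w) hG (Δ := Δ) (u := z) (v := v) (by exact_mod_cast hdist)
  have hsupp := support_subset_uncovered hw ha hz hvU p hp hzv
  -- The first step deals with the entry: `z` is a new center or is updated across its lightest
  -- contracted edge. The remaining `ell` steps follow `p` inside the uncovered part.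
  have hfirst : (WCluster.growStep a.graph Δ s).d z ≤ entryCost a S z := by
    by_cases hzS : z ∈ S
    · rw [((hs.growStep hG ha).center z (Finset.mem_union_right _ hzS)).1]
      exact zero_le
    have hE : entryCost a S z ≠ ⊤ := fun h => by simp [h] at hv
    rw [entryCost, if_neg hzS] at hE hv ⊢
    have hne : a.centers.Nonempty := by
      rw [Finset.nonempty_iff_ne_empty]
      rintro h
      simp [h] at hE
    obtain ⟨c, hc, hcE⟩ := Finset.exists_mem_eq_inf _ hne fun c => a.graph.wt c z
    rw [hcE] at hv ⊢
    have := growStep_d_le_of_wt (s := s) (x := 0) (Δ := Δ) (ha.centers_subset hc)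
      (ha.wt_ne_zero c hc z hz) (hs.center c (Finset.mem_union_left _ hc)).1.le
      (by rw [zero_add]; exact le_self_add.trans hv)
    simpa using this
  -- If `p` has fewer than `ell` edges, the surplus steps do no harm, because values never increase.
  rw [Function.iterate_succ_apply, ← Nat.sub_add_cancel hl, Function.iterate_add_apply]
  refine (iterate_growStep_d_le _ _ _ _ _).trans ?_
  rw [← hp] at hv ⊢
  exact iterate_growStep_d_le_walk hw ha p hsupp hfirst hv

/-- Growing is stable once all nodes at distance at most `Δ` have their final values. -/
lemma Reachable.growStep_eq (hG : G.Connected) (ha : a.Inv G w ρ)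
    (hs : Reachable G w ρ a S Δ s)
    (hd : ∀ v ∈ a.graph.nodes, centerDist G w a S v ≤ Δ → s.d v ≤ centerDist G w a S v) :
    WCluster.growStep a.graph Δ s = s := by
  have key : ∀ v, updaters a.graph Δ s v = ∅ := by
    intro v
    refine Finset.eq_empty_of_forall_notMem fun u hu => ?_
    obtain ⟨hun, -, -, hle, hlt⟩ := mem_updaters.1 hu
    have hvn : v ∈ a.graph.nodes := by
      by_contra hvn
      rw [ha.wt_of_notMem u v hvn, add_top] at hlt
      exact not_top_lt hlt
    have h1 : centerDist G w a S v ≤ s.d u + a.graph.wt u v := by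
      refine (centerDist_le_add_wt hG ha hun).trans ?_
      gcongr
      exact hs.centerDist_le u
    exact absurd (hlt.trans_le ((hd v hvn (h1.trans hle)).trans h1)) (lt_irrefl _)
  cases s with
  | mk ctr d =>
    simp [WCluster.growStep, newD, key]

lemma Reachable.growStep_iterate_eq (hG : G.Connected) (hw : ∀ e ∈ G.edgeSet, 1 ≤ w e)
    (ha : a.Inv G w ρ) (hs : Reachable G w ρ a S Δ s) :
    WCluster.growStep a.graph Δ ((WCluster.growStep a.graph Δ)^[ell G w Δ + 1] s) =
      (WCluster.growStep a.graph Δ)^[ell G w Δ + 1] s :=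
  (hs.iterate hG ha _).growStep_eq hG ha fun _ hvn hv => hs.iterate_d_le hG hw ha hvn hv

/-- The additional step in `L + 1` is the one that finds nothing to update. -/
lemma exists_growUntil_eq {g : CGraph V} {halt : GState V → Prop} {P : GState V → Prop}
    (hP : ∀ s, P s → P (growStep g Δ s)) {L N : ℕ} (hLN : L < N) (hs : P s)
    (hL : growStep g Δ ((growStep g Δ)^[L] s) = (growStep g Δ)^[L] s) :
    ∃ s' j, growUntil g Δ halt N s = some (s', j) ∧ j ≤ L + 1 ∧ P s' ∧
      (growStep g Δ s' = s' ∨ halt s') := by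
  induction N generalizing s L with
  | zero => omega
  | succ N ih =>
    rw [growUntil]
    split_ifs with h
    · refine ⟨_, _, rfl, by omega, hP s hs, ?_⟩
      rcases h with h | h
      · left
        rw [h, h]
      · exact Or.inr h
    · cases L with
      | zero => exact absurd (Or.inl hL) h
      | succ L =>
        rw [Function.iterate_succ_apply] at hL
        obtain ⟨s', j, hj, hjL, hs'⟩ := ih (by omega) (hP s hs) hL
        exact ⟨s', j + 1, by simp [hj], by omega, hs'⟩

lemma Reachable.exists_growUntil_eq (hG : G.Connected) (hw : ∀ e ∈ G.edgeSet, 1 ≤ w e)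
    (ha : a.Inv G w ρ) (hs : Reachable G w ρ a S Δ s) (halt : GState V → Prop) {N : ℕ}
    (hN : ell G w Δ + 2 ≤ N) :
    ∃ s' j, growUntil a.graph Δ halt N s = some (s', j) ∧ j ≤ ell G w Δ + 2 ∧
      Reachable G w ρ a S Δ s' ∧ (WCluster.growStep a.graph Δ s' = s' ∨ halt s') :=
  WCluster.exists_growUntil_eq (fun _ h => h.growStep hG ha) hN hs
    (hs.growStep_iterate_eq hG hw ha)

/-- When growing has come to an end, all uncovered nodes at distance at most `Δ` from a new
center are reached. -/
lemma Reachable.d_le_of_stable (hG : G.Connected) (hw : ∀ e ∈ G.edgeSet, 1 ≤ w e)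
    (ha : a.Inv G w ρ) (hS : S ⊆ a.uncovered) (hs : Reachable G w ρ a S Δ s)
    (hst : WCluster.growStep a.graph Δ s = s) {x v : V} (hx : x ∈ S) (hv : v ∈ a.uncovered)
    (hxv : wdist G w x v ≤ Δ) : s.d v ≤ Δ := by
  have h1 : centerDist G w a S v ≤ Δ := by
    refine (centerDist_le_add (hS hx)).trans ?_
    rw [entryCost_of_mem hx, zero_add]
    exact_mod_cast hxv
  have h2 := hs.iterate_d_le hG hw ha (AState.mem_nodes_of_mem_uncovered hv) h1
  -- A stable state already equals its iterate, so the bound for the iterate applies to it.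
  rw [Function.iterate_fixed hst] at h2
  exact h2.trans h1

/-- The variables after a stage in which the states `s` were reached with threshold `Δ`, where `f` gives
the new weights of the edges between covered and uncovered nodes. -/
noncomputable def nextState (a : AState V) (S : Finset V) (Δ : ℕ) (s : GState V) (f : V → V → ℕ∞)
    (tr : List ℕ) : AState V where
  graph := { nodes := contractNodes a.graph s, wt := contractWt a.graph s f }
  centers := a.centers ∪ S
  asg := assign a.asg (reached a.uncovered Δ s) s
  trace := tr

lemma Reachable.ctr_eq_top_iff (hs : Reachable G w ρ a S Δ s) {v : V} :
    s.ctr v = ⊤ ↔ ¬ s.d v ≤ Δ := by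
  constructor
  · intro h hle
    obtain ⟨-, -, x, -, hx, -⟩ := hs.sound v (ne_top_of_le_ne_top (ENat.natCast_ne_top Δ) hle)
    rw [h] at hx
    exact WithTop.top_ne_coe hx
  · intro h
    by_contra hc
    exact h (hs.sound v fun htop => hc (hs.ctr_of_top v htop)).1

lemma mem_reached {U : Finset V} {v : V} : v ∈ reached U Δ s ↔ v ∈ U ∧ s.d v ≤ Δ := by
  simp [reached]

lemma Reachable.uncovered_nextState (hs : Reachable G w ρ a S Δ s)
    (f : V → V → ℕ∞) (tr : List ℕ) :
    (nextState a S Δ s f tr).uncovered = a.uncovered \ reached a.uncovered Δ s := by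
  ext v
  rw [AState.mem_uncovered, Finset.mem_sdiff, mem_reached]
  simp only [nextState, contractNodes, Finset.mem_filter]
  constructor
  · rintro ⟨⟨hvn, hc⟩, hvX⟩
    have hvU : v ∈ a.uncovered :=
      AState.mem_uncovered.2 ⟨hvn, fun h => hvX (Finset.mem_union_left _ h)⟩
    refine ⟨hvU, fun h => ?_⟩
    rcases hc with hc | hc
    · obtain ⟨-, -, x, hx, hxc, -⟩ :=
        hs.sound v (ne_top_of_le_ne_top (ENat.natCast_ne_top Δ) h.2)
      rw [hc] at hxc
      exact hvX (WithTop.coe_injective hxc ▸ hx)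
    · exact hs.ctr_eq_top_iff.1 hc h.2
  · rintro ⟨hvU, h⟩
    have hd : ¬ s.d v ≤ Δ := fun hd => h ⟨hvU, hd⟩
    refine ⟨⟨AState.mem_nodes_of_mem_uncovered hvU, Or.inr (hs.ctr_eq_top_iff.2 hd)⟩, fun hX => ?_⟩
    rw [(hs.center v hX).1] at hd
    exact hd zero_le

/-- A contraction preserves the invariant if `f u v`, the new weight of an edge from a covered
node `u` to an uncovered node `v`, lies between `d_u + w(u, v) - Δ` and `w(u, v)`. -/
lemma AState.Inv.nextState (hG : G.Connected) (hw : ∀ e ∈ G.edgeSet, 1 ≤ w e) (ha : a.Inv G w ρ) (hS : S ⊆ a.uncovered)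
    (hs : Reachable G w ρ a S Δ s) {f : V → V → ℕ∞} (tr : List ℕ)
    (hf0 : ∀ u v, s.d u ≤ Δ → ¬ s.d v ≤ Δ → a.graph.wt u v ≠ 0 → f u v ≠ 0)
    (hf1 : ∀ u v, s.d u ≤ Δ → f u v ≤ a.graph.wt u v)
    (hf2 : ∀ u v, s.d u ≤ Δ → s.d u + a.graph.wt u v ≤ Δ + f u v) :
    (nextState a S Δ s f tr).Inv G w (ρ + Δ) := by
  have hU := hs.uncovered_nextState f tr
  have hmemU : ∀ v, v ∈ (WCluster.nextState a S Δ s f tr).uncovered ↔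
      v ∈ a.uncovered ∧ ¬ s.d v ≤ Δ := by
    intro v
    rw [hU, Finset.mem_sdiff, mem_reached]
    tauto
  have htop : ∀ v ∈ (WCluster.nextState a S Δ s f tr).uncovered, s.ctr v = ⊤ := fun v hv =>
    hs.ctr_eq_top_iff.2 ((hmemU v).1 hv).2
  have hwt : ∀ c ∈ a.centers ∪ S, ∀ v ∈ (WCluster.nextState a S Δ s f tr).uncovered,
      (WCluster.nextState a S Δ s f tr).graph.wt c v =
        (a.graph.nodes.filter fun u => s.ctr u = c).inf fun u => f u v := by
    intro c hc v hv
    have h1 : ¬ (s.ctr c = ⊤ ∧ s.ctr v = ⊤) := fun h => by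
      rw [(hs.center c hc).2] at h
      exact WithTop.coe_ne_top h.1
    simp only [WCluster.nextState, contractWt]
    rw [if_neg h1, if_pos ⟨(hs.center c hc).2, htop v hv⟩]
  have hctr : ∀ u c : V, s.ctr u = c → s.d u ≤ Δ ∧ (wdist G w c u : ℕ∞) ≤ ρ + s.d u := by
    intro u c hu
    have hne : s.d u ≠ ⊤ := fun h => by
      rw [hs.ctr_of_top u h] at hu
      exact WithTop.top_ne_coe hu
    obtain ⟨h1, -, x, -, hx, hxu⟩ := hs.sound u hne
    rw [hu] at hx
    exact ⟨h1, WithTop.coe_injective hx ▸ hxu⟩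
  have hctrC : ∀ u c : V, u ∈ a.centers → s.ctr u = c → u = c := by
    intro u c hu hc
    rw [(hs.center u (Finset.mem_union_left _ hu)).2] at hc
    exact WithTop.coe_injective hc
  constructor
  case centers_subset =>
    intro x hx
    simp only [WCluster.nextState, contractNodes, Finset.mem_filter] at hx ⊢
    exact ⟨ha.mem_nodes_of_mem_union hS hx, Or.inl (hs.center x hx).2⟩
  case asg_uncovered =>
    intro v hv
    rw [hmemU] at hv
    simp only [WCluster.nextState, assign, mem_reached, if_neg fun h : _ ∧ _ => hv.2 h.2]
    exact ha.asg_uncovered v hv.1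
  case asg_covered =>
    intro v hv
    rw [hmemU] at hv
    by_cases hvU : v ∈ a.uncovered
    · have hd : s.d v ≤ Δ := by tauto
      obtain ⟨-, -, x, hx, hxc, hxv⟩ :=
        hs.sound v (ne_top_of_le_ne_top (ENat.natCast_ne_top Δ) hd)
      refine ⟨x, hx, ?_, ?_⟩
      · simp only [WCluster.nextState, assign, mem_reached, if_pos (And.intro hvU hd), hxc]
      · exact_mod_cast hxv.trans (by gcongr : (ρ : ℕ∞) + s.d v ≤ ρ + Δ)
    · obtain ⟨x, hx, hxc, hxv⟩ := ha.asg_covered v hvU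
      refine ⟨x, Finset.mem_union_left _ hx, ?_, by omega⟩
      simp only [WCluster.nextState, assign, mem_reached, if_neg fun h : _ ∧ _ => hvU h.1, hxc]
  case asg_center =>
    intro x hx
    by_cases hxU : x ∈ a.uncovered
    · have hd : s.d x ≤ Δ := by
        rw [(hs.center x hx).1]
        exact zero_le
      simp only [WCluster.nextState, assign, mem_reached, if_pos (And.intro hxU hd),
        (hs.center x hx).2]
    · simp only [WCluster.nextState, assign, mem_reached, if_neg fun h : _ ∧ _ => hxU h.1]
      refine ha.asg_center x ((Finset.mem_union.1 hx).resolve_right fun h => hxU (hS h))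
  case wt_uncovered =>
    intro u hu v hv
    rw [← ha.wt_uncovered u ((hmemU u).1 hu).1 v ((hmemU v).1 hv).1]
    simp only [WCluster.nextState, contractWt, htop u hu, htop v hv, and_self, if_true]
  case wt_covered =>
    intro y hy v hv hyv
    have hvU := ((hmemU v).1 hv).1
    rw [hmemU] at hy
    by_cases hyU : y ∈ a.uncovered
    · have hd : s.d y ≤ Δ := by tauto
      obtain ⟨-, hyn, x, hx, hxc, -⟩ :=
        hs.sound y (ne_top_of_le_ne_top (ENat.natCast_ne_top Δ) hd)
      refine ⟨x, hx, ?_⟩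
      rw [hwt x hx v hv]
      refine (Finset.inf_le (Finset.mem_filter.2 ⟨hyn, hxc⟩)).trans ((hf1 y v hd).trans ?_)
      rw [ha.wt_uncovered y hyU v hvU, ofGraph_wt_of_adj hyv]
    · obtain ⟨c, hc, hle⟩ := ha.wt_covered y hyU v hvU hyv
      have hcX := Finset.mem_union_left S hc
      refine ⟨c, hcX, ?_⟩
      rw [hwt c hcX v hv]
      refine (Finset.inf_le (Finset.mem_filter.2
        ⟨ha.centers_subset hc, (hs.center c hcX).2⟩)).trans ((hf1 c v ?_).trans hle)
      rw [(hs.center c hcX).1]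
      exact zero_le
  case wt_ne_zero =>
    intro c hc v hv
    obtain ⟨hvU, hvd⟩ := (hmemU v).1 hv
    rw [hwt c hc v hv, ← pos_iff_ne_zero, Finset.lt_inf_iff (by simp)]
    intro u hu
    rw [Finset.mem_filter] at hu
    refine pos_iff_ne_zero.2 (hf0 u v (hctr u c hu.2).1 hvd ?_)
    by_cases huC : u ∈ a.centers
    · exact ha.wt_ne_zero u huC v hvU
    · rw [ha.wt_uncovered u (AState.mem_uncovered.2 ⟨hu.1, huC⟩) v hvU]
      by_cases hadj : G.Adj u v
      · rw [ofGraph_wt_of_adj hadj]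
        have := hw s(u, v) hadj
        exact_mod_cast (by omega : w s(u, v) ≠ 0)
      · simp [ofGraph_wt_of_not_adj hadj]
  case wdist_le =>
    intro c hc v hv
    obtain ⟨hvU, hvd⟩ := (hmemU v).1 hv
    rw [hwt c hc v hv]
    have hne : (a.graph.nodes.filter fun u => s.ctr u = c).Nonempty :=
      ⟨c, Finset.mem_filter.2 ⟨ha.mem_nodes_of_mem_union hS hc, (hs.center c hc).2⟩⟩
    obtain ⟨u, hu, huf⟩ := Finset.exists_mem_eq_inf _ hne fun u => f u v
    rw [huf]
    rw [Finset.mem_filter] at hu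
    obtain ⟨hd, hcu⟩ := hctr u c hu.2
    rw [Nat.cast_add, add_assoc]
    refine le_trans ?_ (add_le_add_right (hf2 u v hd) _)
    -- If `u` is an old center, then `c = u` and the error `ρ` sits in the weight of the contracted
    -- edge; otherwise it sits in the distance from `c` to `u` and the edge belongs to `G`.
    by_cases huC : u ∈ a.centers
    · obtain rfl := hctrC u c huC hu.2
      refine (ha.wdist_le u huC v hvU).trans ?_
      gcongr
      exact le_add_self
    · rw [ha.wt_uncovered u (AState.mem_uncovered.2 ⟨hu.1, huC⟩) v hvU]
      by_cases hadj : G.Adj u v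
      · rw [ofGraph_wt_of_adj hadj, ← add_assoc]
        calc (wdist G w c v : ℕ∞) ≤ wdist G w c u + w s(u, v) := by
              exact_mod_cast (wdist_triangle hG c u v).trans
                (Nat.add_le_add_left (wdist_le_of_adj hadj) _)
          _ ≤ _ := by gcongr
      · simp [ofGraph_wt_of_not_adj hadj]
  case wt_of_notMem =>
    intro u v hv
    simp only [WCluster.nextState, contractNodes, Finset.mem_filter, not_and, not_or] at hv
    simp only [WCluster.nextState, contractWt]
    by_cases hvn : v ∈ a.graph.nodes
    · obtain ⟨h1, h2⟩ := hv hvn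
      rw [if_neg (fun h => h2 h.2), if_neg (fun h => h2 h.2), if_neg (fun h => h1 h.2)]
    · have hvt : s.ctr v = ⊤ := by
        by_contra hc
        exact hvn (hs.sound v fun h => hc (hs.ctr_of_top v h)).2.1
      split_ifs with h1 h2 h3
      · exact ha.wt_of_notMem u v hvn
      · rw [eq_top_iff, Finset.le_inf_iff]
        intro x hx
        rw [Finset.mem_filter] at hx
        -- For an absent edge the left-hand side of this bound is infinite, which forces `f x v =
        -- ⊤`: contraction creates no edge to a removed node.
        have h4 := hf2 x v (hctr x u hx.2).1
        rw [ha.wt_of_notMem x v hvn, add_top, top_le_iff, ENat.add_eq_top] at h4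
        exact (h4.resolve_left (ENat.natCast_ne_top Δ)).ge
      · rw [hvt] at h3
        exact absurd h3.2 WithTop.top_ne_coe
      · rfl

end Growing

/-! ### One stage: covered balls, the two contractions, and the doubling of the threshold. -/

section Stage

variable {V : Type*} [Fintype V] [LinearOrder V] {G : SimpleGraph V} {w : Sym2 V → ℕ}
  {ρ Δ : ℕ} {a : AState V} {S : Finset V} {s : GState V}

open Classical in
/-- The nodes of `U` at distance at most `r` from some node of `S`. -/
noncomputable def ballNodes (G : SimpleGraph V) (w : Sym2 V → ℕ) (U S : Finset V) (r : ℕ) :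
    Finset V :=
  U.filter fun u => ∃ x ∈ S, wdist G w x u ≤ r

lemma Reachable.ballNodes_subset (hG : G.Connected) (hw : ∀ e ∈ G.edgeSet, 1 ≤ w e)
    (ha : a.Inv G w ρ) (hS : S ⊆ a.uncovered) (hs : Reachable G w ρ a S Δ s)
    (hst : WCluster.growStep a.graph Δ s = s) {r : ℕ} (hr : r ≤ Δ) :
    ballNodes G w a.uncovered S r ⊆ reached a.uncovered Δ s := by
  intro u hu
  simp only [ballNodes, Finset.mem_filter] at hu
  obtain ⟨huU, x, hx, hxu⟩ := hu
  exact mem_reached.2 ⟨huU, hs.d_le_of_stable hG hw ha hS hst hx huU (hxu.trans hr)⟩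

lemma AState.Inv.contract (hG : G.Connected) (hw : ∀ e ∈ G.edgeSet, 1 ≤ w e)
    (ha : a.Inv G w ρ) (hS : S ⊆ a.uncovered) (hs : Reachable G w ρ a S Δ s) (tr : List ℕ) :
    (WCluster.nextState a S Δ s a.graph.wt tr).Inv G w (ρ + Δ) :=
  ha.nextState hG hw hS hs tr (fun _ _ _ _ h => h) (fun _ _ _ => le_rfl)
    fun _ _ h => add_le_add_left h _

/-- Stability keeps the rescaled weights positive: if `d_u + w(u, v) ≤ Δ`, one more growing step
would have reached `v`. -/
lemma AState.Inv.contract2 (hG : G.Connected) (hw : ∀ e ∈ G.edgeSet, 1 ≤ w e)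
    (ha : a.Inv G w ρ) (hS : S ⊆ a.uncovered) (hs : Reachable G w ρ a S Δ s)
    (hst : WCluster.growStep a.graph Δ s = s) (tr : List ℕ) :
    (WCluster.nextState a S Δ s
      (fun u v => if a.graph.wt u v ≤ Δ then s.d u + a.graph.wt u v - Δ else a.graph.wt u v)
      tr).Inv G w (ρ + Δ) := by
  refine ha.nextState hG hw hS hs tr ?_ ?_ ?_
  · intro u v hu hv h0
    split_ifs
    · rw [ne_eq, tsub_eq_zero_iff_le]
      intro hle
      have := growStep_d_le_of_wt (s := s)
        (hs.sound u (ne_top_of_le_ne_top (ENat.natCast_ne_top Δ) hu)).2.1 h0 le_rfl hle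
      rw [hst] at this
      exact hv (this.trans hle)
    · exact h0
  · intro u v hu
    split_ifs
    · rw [tsub_le_iff_left]
      gcongr
    · exact le_rfl
  · intro u v hu
    split_ifs
    · exact le_add_tsub
    · gcongr

/-- If at least half of the uncovered nodes are at distance at most `r` from the new centers, then
the inner loop of CLUSTER ends with a threshold of at most `B`, for any `B ≥ 2 r` that bounds the
initial threshold. -/
lemma exists_innerLoop_eq (hG : G.Connected) (hw : ∀ e ∈ G.edgeSet, 1 ≤ w e)
    (ha : a.Inv G w ρ) (hS : S ⊆ a.uncovered) {r B N : ℕ} (hN : ell G w B + 2 ≤ N)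
    (hB : 2 * r ≤ B) (hhalf : a.uncovered.card ≤ 2 * (ballNodes G w a.uncovered S r).card)
    (M : ℕ) (hs : Reachable G w ρ a S Δ s) (hΔ : Δ ≤ B) (hM : r ≤ Δ * 2 ^ M) :
    ∃ s' m tr, innerLoop N a.graph a.uncovered (M + 1) Δ s = some (s', Δ * 2 ^ m, tr) ∧
      Reachable G w ρ a S (Δ * 2 ^ m) s' ∧ Δ * 2 ^ m ≤ B ∧
      a.uncovered.card ≤ 2 * (reached a.uncovered (Δ * 2 ^ m) s').card ∧
      tr.length ≤ (m + 1) * (ell G w B + 2) ∧ ∀ x ∈ tr, x ≤ B := by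
  induction M generalizing Δ s with
  | zero =>
    have hell : ell G w Δ ≤ ell G w B := ell_mono hG (by exact_mod_cast hΔ)
    obtain ⟨s', j, hj, hjL, hs', hhalt⟩ := hs.exists_growUntil_eq hG hw ha
      (fun s' => a.uncovered.card ≤ 2 * (reached a.uncovered Δ s').card) (N := N) (by omega)
    have hcard : a.uncovered.card ≤ 2 * (reached a.uncovered Δ s').card := by
      rcases hhalt with hst | h
      · have := Finset.card_le_card (hs'.ballNodes_subset hG hw ha hS hst (by simpa using hM))
        omega
      · exact h
    refine ⟨s', 0, List.replicate j Δ, ?_, by simpa using hs', by simpa using hΔ,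
      by simpa using hcard, by simp; omega, fun x hx => (List.eq_of_mem_replicate hx).trans_le hΔ⟩
    rw [innerLoop, partialGrowth, hj]
    simp only [if_neg (not_lt.2 hcard), pow_zero, mul_one]
  | succ M ih =>
    have hell : ell G w Δ ≤ ell G w B := ell_mono hG (by exact_mod_cast hΔ)
    obtain ⟨s', j, hj, hjL, hs', hhalt⟩ := hs.exists_growUntil_eq hG hw ha
      (fun s' => a.uncovered.card ≤ 2 * (reached a.uncovered Δ s').card) (N := N) (by omega)
    by_cases hcard : a.uncovered.card ≤ 2 * (reached a.uncovered Δ s').card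
    · refine ⟨s', 0, List.replicate j Δ, ?_, by simpa using hs', by simpa using hΔ,
        by simpa using hcard, by simp; omega,
        fun x hx => (List.eq_of_mem_replicate hx).trans_le hΔ⟩
      rw [innerLoop, partialGrowth, hj]
      simp only [if_neg (not_lt.2 hcard), pow_zero, mul_one]
    · have hst := hhalt.resolve_right hcard
      -- An attempt fails only with `Δ < r`, since otherwise the balls of radius `r` would have been
      -- reached. So the doubled threshold stays below `2 r ≤ B`.
      have hlt : Δ < r := by
        by_contra hle
        have := Finset.card_le_card (hs'.ballNodes_subset hG hw ha hS hst (not_lt.1 hle))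
        omega
      obtain ⟨s'', m, tr, h1, h2, h3, h4, h5, h6⟩ := ih (hs'.mono (by omega : Δ ≤ 2 * Δ))
        (by omega) (hM.trans_eq (by ring))
      have hpow : 2 * Δ * 2 ^ m = Δ * 2 ^ (m + 1) := by ring
      rw [hpow] at h1 h2 h3 h4
      refine ⟨s'', m + 1, List.replicate j Δ ++ tr, ?_, h2, h3, h4, ?_, ?_⟩
      · rw [innerLoop, partialGrowth, hj]
        simp only [if_pos (not_le.1 hcard), h1, Option.map_some]
      · rw [List.length_append, List.length_replicate]
        have : (m + 1 + 1) * (ell G w B + 2) = (m + 1) * (ell G w B + 2) + (ell G w B + 2) := by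
          ring
        omega
      · intro x hx
        rcases List.mem_append.1 hx with hx | hx
        · exact (List.eq_of_mem_replicate hx).trans_le hΔ
        · exact h6 x hx

end Stage

/-! ### Failure probabilities and independent selection. -/

section Probability

lemma toOuterMeasure_univ {α : Type*} (μ : PMF α) : μ.toOuterMeasure Set.univ = 1 := by
  rw [PMF.toOuterMeasure_apply, Set.indicator_univ, PMF.tsum_coe]

lemma toOuterMeasure_le_one {α : Type*} (μ : PMF α) (A : Set α) : μ.toOuterMeasure A ≤ 1 :=
  (MeasureTheory.measure_mono (Set.subset_univ A)).trans_eq (toOuterMeasure_univ μ)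

/-- The probability of a failure adds up in a sequential composition. -/
lemma toOuterMeasure_bind_compl_le {α β : Type*} (μ : PMF α) (f : α → PMF β) (A : Set α)
    (B : Set β) {ε δ : ℝ≥0∞} (hμ : μ.toOuterMeasure Aᶜ ≤ ε)
    (hf : ∀ x ∈ A, (f x).toOuterMeasure Bᶜ ≤ δ) :
    (μ.bind f).toOuterMeasure Bᶜ ≤ ε + δ := by
  classical
  rw [PMF.toOuterMeasure_bind_apply]
  calc ∑' x, μ x * (f x).toOuterMeasure Bᶜ
      ≤ ∑' x, (Aᶜ.indicator μ x + μ x * δ) := by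
        refine ENNReal.tsum_le_tsum fun x => ?_
        by_cases hx : x ∈ A
        · rw [Set.indicator_of_notMem (by simpa using hx), zero_add]
          gcongr
          exact hf x hx
        · rw [Set.indicator_of_mem (by simpa using hx)]
          refine le_trans ?_ le_self_add
          calc μ x * (f x).toOuterMeasure Bᶜ ≤ μ x * 1 := by
                gcongr
                exact toOuterMeasure_le_one _ _
            _ = μ x := mul_one _
    _ = μ.toOuterMeasure Aᶜ + δ := by
        rw [ENNReal.tsum_add, ENNReal.tsum_mul_right, PMF.tsum_coe, one_mul,
          PMF.toOuterMeasure_apply]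
    _ ≤ ε + δ := by gcongr

lemma one_sub_le_toOuterMeasure {α : Type*} (μ : PMF α) {A : Set α} {ε : ℝ≥0∞}
    (h : μ.toOuterMeasure Aᶜ ≤ ε) : 1 - ε ≤ μ.toOuterMeasure A := by
  rw [tsub_le_iff_right]
  calc 1 = μ.toOuterMeasure Set.univ := (toOuterMeasure_univ μ).symm
    _ ≤ μ.toOuterMeasure A + μ.toOuterMeasure Aᶜ := by
        rw [← Set.union_compl_self A]
        exact MeasureTheory.measure_union_le _ _
    _ ≤ _ := by gcongr

variable {V : Type*} [Fintype V] [DecidableEq V]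

lemma select_toOuterMeasure (U : Finset V) (p : ℝ≥0∞) (A : Set (Finset V)) [DecidablePred (· ∈ A)] :
    (select U p).toOuterMeasure A = ∑ S ∈ U.powerset with S ∈ A,
      (min p 1) ^ S.card * (1 - min p 1) ^ (U.card - S.card) := by
  rw [PMF.toOuterMeasure_apply, tsum_eq_sum (s := U.powerset), Finset.sum_filter]
  · refine Finset.sum_congr rfl fun S hS => ?_
    have hS' := Finset.mem_powerset.1 hS
    by_cases hA : S ∈ A
    · rw [Set.indicator_of_mem hA, if_pos hA]
      simp only [select, PMF.ofFinset_apply, if_pos hS', Finset.card_sdiff_of_subset hS']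
    · rw [Set.indicator_of_notMem hA, if_neg hA]
  · intro S hS
    have hS' : ¬ S ⊆ U := fun h => hS (Finset.mem_powerset.2 h)
    rw [Set.indicator_apply_eq_zero]
    intro _
    simp only [select, PMF.ofFinset_apply, if_neg hS']

lemma select_not_subset (U : Finset V) (p : ℝ≥0∞) :
    (select U p).toOuterMeasure {S | S ⊆ U}ᶜ = 0 := by
  classical
  rw [select_toOuterMeasure]
  refine Finset.sum_eq_zero fun S hS => ?_
  rw [Finset.mem_filter, Finset.mem_powerset] at hS
  exact absurd hS.1 hS.2

/-- The probability that no element of `B` is selected. -/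
lemma select_disjoint {U B : Finset V} (hB : B ⊆ U) (p : ℝ≥0∞) :
    (select U p).toOuterMeasure {S | Disjoint S B} = (1 - min p 1) ^ B.card := by
  classical
  rw [select_toOuterMeasure]
  have hset : (U.powerset.filter fun S => S ∈ {S : Finset V | Disjoint S B}) = (U \ B).powerset := by
    ext S
    simp only [Finset.mem_filter, Finset.mem_powerset, Set.mem_ofPred_eq, Finset.subset_sdiff]
  rw [hset]
  have hcard : (U \ B).card + B.card = U.card := Finset.card_sdiff_add_card_eq_card hB
  calc ∑ S ∈ (U \ B).powerset, (min p 1) ^ S.card * (1 - min p 1) ^ (U.card - S.card)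
      = ∑ S ∈ (U \ B).powerset, (1 - min p 1) ^ B.card *
          ((min p 1) ^ S.card * (1 - min p 1) ^ ((U \ B).card - S.card)) := by
        refine Finset.sum_congr rfl fun S hS => ?_
        have := Finset.card_le_card (Finset.mem_powerset.1 hS)
        rw [show U.card - S.card = B.card + ((U \ B).card - S.card) by omega, pow_add]
        ring
    _ = _ := by
        rw [← Finset.mul_sum, Finset.sum_pow_mul_eq_add_pow,
          add_tsub_cancel_of_le (min_le_right p 1), one_pow, mul_one]

lemma ennreal_le_ofReal_exp {q : ℝ≥0∞} (hq : q ≤ 1) :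
    1 - q ≤ ENNReal.ofReal (Real.exp (-q.toReal)) ∧
      1 + q ≤ ENNReal.ofReal (Real.exp q.toReal) := by
  have hqt : q ≠ ⊤ := ne_top_of_le_ne_top ENNReal.one_ne_top hq
  have hq' : q = ENNReal.ofReal q.toReal := (ENNReal.ofReal_toReal hqt).symm
  constructor
  · nth_rw 1 [hq']
    rw [← ENNReal.ofReal_one, ← ENNReal.ofReal_sub _ ENNReal.toReal_nonneg]
    exact ENNReal.ofReal_le_ofReal (by linarith [Real.add_one_le_exp (-q.toReal)])
  · nth_rw 1 [hq']
    rw [← ENNReal.ofReal_one, ← ENNReal.ofReal_add zero_le_one ENNReal.toReal_nonneg]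
    exact ENNReal.ofReal_le_ofReal (by linarith [Real.add_one_le_exp q.toReal])

lemma select_disjoint_le {U B : Finset V} (hB : B ⊆ U) (p : ℝ≥0∞) :
    (select U p).toOuterMeasure {S | Disjoint S B} ≤
      ENNReal.ofReal (Real.exp (-((min p 1).toReal * B.card))) := by
  rw [select_disjoint hB]
  refine (pow_le_pow_left' (ennreal_le_ofReal_exp (min_le_right p 1)).1 _).trans_eq ?_
  rw [← ENNReal.ofReal_pow (Real.exp_nonneg _), ← Real.exp_nat_mul]
  congr 2
  ring

/-- A Chernoff bound for the number of selected elements. -/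
lemma select_card_gt_le (U : Finset V) (p : ℝ≥0∞) (t : ℝ) :
    (select U p).toOuterMeasure {S | (S.card : ℝ) ≤ t}ᶜ ≤
      ENNReal.ofReal (Real.exp ((min p 1).toReal * U.card - t * Real.log 2)) := by
  classical
  rw [select_toOuterMeasure]
  set q := min p 1 with hq
  have hq1 : q ≤ 1 := min_le_right p 1
  calc ∑ S ∈ U.powerset with S ∈ {S : Finset V | (S.card : ℝ) ≤ t}ᶜ,
        q ^ S.card * (1 - q) ^ (U.card - S.card)
      ≤ ∑ S ∈ U.powerset with S ∈ {S : Finset V | (S.card : ℝ) ≤ t}ᶜ,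
          ENNReal.ofReal (Real.exp (-(t * Real.log 2))) *
            ((2 * q) ^ S.card * (1 - q) ^ (U.card - S.card)) := by
        refine Finset.sum_le_sum fun S hS => ?_
        rw [Finset.mem_filter, Set.mem_compl_iff, Set.mem_ofPred_eq, not_le] at hS
        -- Markov's inequality for `2 ^ |S|`: on the event `|S| > t` this factor is at least 1. The
        -- weighted sum over all `S` is then the binomial expansion of `(2 q + (1 - q)) ^ |U|`.
        have h1 : 1 ≤ ENNReal.ofReal (Real.exp (-(t * Real.log 2))) * 2 ^ S.card := by
          rw [show (2 : ℝ≥0∞) = ENNReal.ofReal 2 by simp,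
            ← ENNReal.ofReal_pow zero_le_two, ← ENNReal.ofReal_mul (Real.exp_nonneg _),
            ENNReal.one_le_ofReal]
          have h2 : (2 : ℝ) ^ S.card = Real.exp (S.card * Real.log 2) := by
            rw [Real.exp_nat_mul, Real.exp_log zero_lt_two]
          rw [h2, ← Real.exp_add, Real.one_le_exp_iff]
          nlinarith [Real.log_pos one_lt_two, hS.2]
        calc q ^ S.card * (1 - q) ^ (U.card - S.card)
            = 1 * (q ^ S.card * (1 - q) ^ (U.card - S.card)) := (one_mul _).symm
          _ ≤ (ENNReal.ofReal (Real.exp (-(t * Real.log 2))) * 2 ^ S.card) *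
              (q ^ S.card * (1 - q) ^ (U.card - S.card)) := by gcongr
          _ = _ := by rw [mul_pow]; ring
    _ ≤ ∑ S ∈ U.powerset, ENNReal.ofReal (Real.exp (-(t * Real.log 2))) *
            ((2 * q) ^ S.card * (1 - q) ^ (U.card - S.card)) :=
        Finset.sum_le_sum_of_subset (Finset.filter_subset _ _)
    _ = ENNReal.ofReal (Real.exp (-(t * Real.log 2))) * (1 + q) ^ U.card := by
        rw [← Finset.mul_sum, Finset.sum_pow_mul_eq_add_pow, two_mul, add_assoc,
          add_tsub_cancel_of_le hq1, add_comm q 1]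
    _ ≤ ENNReal.ofReal (Real.exp (-(t * Real.log 2))) *
          ENNReal.ofReal (Real.exp q.toReal) ^ U.card := by
        gcongr
        exact (ennreal_le_ofReal_exp hq1).2
    _ = _ := by
        rw [← ENNReal.ofReal_pow (Real.exp_nonneg _), ← Real.exp_nat_mul,
          ← ENNReal.ofReal_mul (Real.exp_nonneg _), ← Real.exp_add]
        congr 2
        ring

/-- With probability one all elements are selected. -/
lemma select_ne_self {U : Finset V} {p : ℝ≥0∞} (hp : 1 ≤ p) :
    (select U p).toOuterMeasure {S | S = U}ᶜ = 0 := by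
  classical
  rw [select_toOuterMeasure]
  refine Finset.sum_eq_zero fun S hS => ?_
  rw [Finset.mem_filter, Finset.mem_powerset, Set.mem_compl_iff, Set.mem_ofPred_eq] at hS
  have := Finset.card_lt_card (lt_of_le_of_ne hS.1 hS.2)
  rw [min_eq_right hp, tsub_self, zero_pow (by omega), mul_zero]

/-- The elements of a partition of `U` into at most `W` classes are mostly hit. -/
lemma select_hit_le {U : Finset V} (c : V → V) {W : ℕ} (hW : (Finset.univ.image c).card ≤ W)
    (p : ℝ≥0∞) {x : ℝ} (hx : 2 * W * x ≤ (min p 1).toReal * U.card) :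
    (select U p).toOuterMeasure
      {S | U.card ≤ 2 * (U.filter fun u => ∃ y ∈ S, c y = c u).card}ᶜ ≤
      W * ENNReal.ofReal (Real.exp (-x)) := by
  classical
  -- The classes that hold at least a fraction `1 / (2 W)` of `U`. If all of them are hit, the
  -- missed nodes lie in at most `W` smaller classes, which together contain at most half of `U`.
  set big : Finset V := (Finset.univ.image c).filter fun z =>
    U.card ≤ 2 * W * (U.filter fun u => c u = z).card with hbig
  have hsub : {S : Finset V | U.card ≤ 2 * (U.filter fun u => ∃ y ∈ S, c y = c u).card}ᶜ ⊆
      ⋃ z ∈ big, {S | Disjoint S (U.filter fun u => c u = z)} := by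
    intro S hS
    by_contra hno
    refine hS ?_
    simp only [Set.mem_iUnion, Set.mem_ofPred_eq, not_exists, Finset.not_disjoint_iff] at hno
    rw [Set.mem_ofPred_eq]
    set H := U.filter fun u => ∃ y ∈ S, c y = c u
    have hsmall : 2 * (U \ H).card ≤ U.card := by
      rcases Nat.eq_zero_or_pos W with rfl | hWpos
      · have h0 : (Finset.univ.image c) = ∅ := Finset.card_eq_zero.1 (Nat.le_zero.1 hW)
        have : U = ∅ := Finset.eq_empty_of_forall_notMem fun u _ => by
          have := Finset.mem_image_of_mem c (Finset.mem_univ u)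
          simp [h0] at this
        simp [this]
      have hle : W * (2 * (U \ H).card) ≤ W * U.card := by
        calc W * (2 * (U \ H).card)
            = 2 * W * ∑ z ∈ Finset.univ.image c, ((U \ H).filter fun u => c u = z).card := by
              rw [← Finset.card_eq_sum_card_fiberwise
                fun u _ => Finset.mem_coe.2 (Finset.mem_image_of_mem c (Finset.mem_univ u))]
              ring
          _ = ∑ z ∈ Finset.univ.image c, 2 * W * ((U \ H).filter fun u => c u = z).card :=
              Finset.mul_sum _ _ _
          _ ≤ ∑ z ∈ Finset.univ.image c, U.card := by
              refine Finset.sum_le_sum fun z hz => ?_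
              by_cases hzb : z ∈ big
              · obtain ⟨y, hy, hyz⟩ := hno z hzb
                have : ((U \ H).filter fun u => c u = z) = ∅ := by
                  refine Finset.eq_empty_of_forall_notMem fun u hu => ?_
                  rw [Finset.mem_filter, Finset.mem_sdiff] at hu
                  exact hu.1.2 (Finset.mem_filter.2 ⟨hu.1.1, y, hy, by
                    rw [(Finset.mem_filter.1 hyz).2, hu.2]⟩)
                simp [this]
              · have h1 : 2 * W * (U.filter fun u => c u = z).card < U.card := by
                  by_contra h
                  exact hzb (Finset.mem_filter.2 ⟨hz, not_lt.1 h⟩)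
                refine le_trans ?_ h1.le
                gcongr
                exact Finset.sdiff_subset
          _ ≤ W * U.card := by
              rw [Finset.sum_const, smul_eq_mul]
              gcongr
      exact Nat.le_of_mul_le_mul_left hle hWpos
    have : (U \ H).card + H.card = U.card :=
      Finset.card_sdiff_add_card_eq_card (Finset.filter_subset _ U)
    omega
  calc _ ≤ (select U p).toOuterMeasure
        (⋃ z ∈ big, {S | Disjoint S (U.filter fun u => c u = z)}) :=
        MeasureTheory.measure_mono hsub
    _ ≤ ∑ z ∈ big, (select U p).toOuterMeasure {S | Disjoint S (U.filter fun u => c u = z)} :=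
        MeasureTheory.measure_biUnion_finset_le _ _
    _ ≤ ∑ z ∈ big, ENNReal.ofReal (Real.exp (-x)) := by
        refine Finset.sum_le_sum fun z hz => ?_
        refine (select_disjoint_le (Finset.filter_subset _ _) p).trans ?_
        gcongr
        rw [hbig, Finset.mem_filter, Finset.mem_image] at hz
        obtain ⟨⟨y, -, hy⟩, hz⟩ := hz
        have hWpos : 0 < W :=
          (Finset.card_pos.2 ⟨_, Finset.mem_image_of_mem c (Finset.mem_univ y)⟩).trans_le hW
        have hz' : (U.card : ℝ) ≤ 2 * W * (U.filter fun u => c u = z).card := by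
          exact_mod_cast hz
        -- On average at least `x` members of a big class are selected, so it is missed with
        -- probability at most `e^{-x}`.
        have h2 : 2 * (W : ℝ) * x ≤
            2 * W * ((min p 1).toReal * (U.filter fun u => c u = z).card) :=
          hx.trans ((mul_le_mul_of_nonneg_left hz' ENNReal.toReal_nonneg).trans_eq (by ring))
        exact le_of_mul_le_mul_left h2 (by positivity)
    _ ≤ _ := by
        rw [Finset.sum_const, nsmul_eq_mul]
        gcongr
        exact (Finset.card_filter_le _ _).trans hW

end Probability

/-! ### Analysis of CLUSTER. -/

section Cluster

variable {V : Type*} [Fintype V] [LinearOrder V] {G : SimpleGraph V} {w : Sym2 V → ℕ}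
  {a : AState V} {S : Finset V}

lemma AState.Inv.mono {ρ ρ' : ℕ} (ha : a.Inv G w ρ) (h : ρ ≤ ρ') : a.Inv G w ρ' where
  __ := ha
  asg_covered v hv := by
    obtain ⟨x, hx, hxc, hxv⟩ := ha.asg_covered v hv
    exact ⟨x, hx, hxc, hxv.trans h⟩
  wdist_le c hc v hv := (ha.wdist_le c hc v hv).trans (by gcongr)

lemma wdist_le_radius (c : V → V) (v : V) : wdist G w (c v) v ≤ radius G w c :=
  Finset.le_sup (f := fun v => wdist G w (c v) v) (Finset.mem_univ v)

lemma toOuterMeasure_inter_compl_le {α : Type*} (μ : PMF α) (A B : Set α) {ε δ : ℝ≥0∞}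
    (hA : μ.toOuterMeasure Aᶜ ≤ ε) (hB : μ.toOuterMeasure Bᶜ ≤ δ) :
    μ.toOuterMeasure (A ∩ B)ᶜ ≤ ε + δ := by
  rw [Set.compl_inter]
  exact (MeasureTheory.measure_union_le _ _).trans (add_le_add hA hB)

/-- With a high probability, at least half of `U` is close to the selected nodes. -/
lemma select_ballNodes_le (hG : G.Connected) {U : Finset V} (c : V → V) {W : ℕ}
    (hW : (Finset.univ.image c).card ≤ W) (p : ℝ≥0∞) {x : ℝ}
    (hx : 2 * W * x ≤ (min p 1).toReal * U.card) :
    (select U p).toOuterMeasure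
      {S | U.card ≤ 2 * (ballNodes G w U S (2 * radius G w c)).card}ᶜ ≤
      W * ENNReal.ofReal (Real.exp (-x)) := by
  refine le_trans (MeasureTheory.measure_mono ?_) (select_hit_le c hW p hx)
  rw [Set.compl_subset_compl]
  intro S hS
  refine le_trans (Set.mem_ofPred_eq ▸ hS) (Nat.mul_le_mul_left 2 (Finset.card_le_card ?_))
  intro u hu
  rw [Finset.mem_filter] at hu
  obtain ⟨huU, y, hy, hyu⟩ := hu
  simp only [ballNodes, Finset.mem_filter]
  refine ⟨huU, y, hy, ?_⟩
  -- Nodes `y` and `u` of one cluster are joined through their common center.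
  have h1 := wdist_triangle (w := w) hG y (c u) u
  have h2 := wdist_le_radius (G := G) (w := w) c u
  have h3 := wdist_le_radius (G := G) (w := w) c y
  rw [wdist_comm hG, hyu] at h3
  omega

/-- The failure probability of a stage of CLUSTER. -/
lemma select_cluster_stage_le (hG : G.Connected) (hn : 2 ≤ Fintype.card V) {τ : ℕ} (hτ : 1 ≤ τ)
    {c : V → V} (hc : (Finset.univ.image c).card ≤ τ) {U : Finset V}
    (hU : 8 * (τ : ℝ) * Real.logb 2 (Fintype.card V) ≤ U.card) :
    (select U (ENNReal.ofReal
      (4 * Real.log 2 * τ * Real.logb 2 (Fintype.card V) / U.card))).toOuterMeasure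
      ({S | S ⊆ U} ∩ ({S | (S.card : ℝ) ≤ 6 * τ * Real.logb 2 (Fintype.card V)} ∩
        {S | U.card ≤ 2 * (ballNodes G w U S (2 * radius G w c)).card}))ᶜ ≤
      2 * τ * ENNReal.ofReal (Real.exp (-(2 * Real.log (Fintype.card V)))) := by
  have hl2 : 0 < Real.log 2 := Real.log_pos one_lt_two
  have hl2' : Real.log 2 ≤ 1 := by linarith [Real.log_two_lt_d9]
  have hτ' : (1 : ℝ) ≤ τ := by exact_mod_cast hτ
  set lg := Real.logb 2 (Fintype.card V) with hlg
  have hn' : (2 : ℝ) ≤ Fintype.card V := by exact_mod_cast hn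
  have hln : Real.log (Fintype.card V) = Real.log 2 * lg := by
    rw [hlg, Real.logb]
    field_simp
  have hlg1 : 1 ≤ lg := by
    rw [hlg, Real.le_logb_iff_rpow_le one_lt_two (by linarith)]
    simpa using hn'
  have hτlg : 1 ≤ τ * lg := by nlinarith
  have hUpos : (0 : ℝ) < U.card := by nlinarith
  set x := 4 * Real.log 2 * τ * lg / U.card with hx
  have hx0 : 0 ≤ x := by positivity
  -- The loop condition keeps the quotient below 1, so the truncation in `select` has no effect.
  have hx1 : x ≤ 1 := by
    rw [hx, div_le_one hUpos]
    nlinarith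
  have hmin : (min (ENNReal.ofReal x) 1).toReal = x := by
    rw [min_eq_left (by simpa using hx1), ENNReal.toReal_ofReal hx0]
  have hxU : x * U.card = 4 * Real.log 2 * τ * lg := by
    rw [hx]
    field_simp
  have h1 := select_not_subset U (ENNReal.ofReal x)
  have h2 := select_card_gt_le U (ENNReal.ofReal x) (6 * τ * lg)
  -- The expected number `4 τ ln n` of selected nodes is exactly `2 τ x` for `x = 2 ln n`.
  have h3 := select_ballNodes_le (w := w) hG (U := U) c hc (ENNReal.ofReal x)
    (x := 2 * Real.log (Fintype.card V)) (by rw [hmin, hxU, hln]; nlinarith)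
  refine (toOuterMeasure_inter_compl_le _ _ _ h1.le
    (toOuterMeasure_inter_compl_le _ _ _ h2 h3)).trans ?_
  rw [zero_add, hmin, hxU, mul_assoc 2, two_mul ((τ : ℝ≥0∞) * _)]
  refine add_le_add ?_ le_rfl
  -- The Chernoff exponent is `(4 - 6) τ ln n`, hence at most `-2 ln n`.
  calc _ ≤ 1 * ENNReal.ofReal (Real.exp (-(2 * Real.log (Fintype.card V)))) := by
        rw [one_mul]
        refine ENNReal.ofReal_le_ofReal (Real.exp_le_exp.2 ?_)
        rw [hln]
        nlinarith [mul_le_mul_of_nonneg_left hτ' (by positivity : 0 ≤ Real.log 2 * lg)]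
    _ ≤ _ := by
        gcongr
        exact_mod_cast hτ

/-- The invariant of the outer loop of CLUSTER after `j` stages and `m` doublings of the threshold,
with initial threshold `Δ₀`. -/
structure ClusterInv (G : SimpleGraph V) (w : Sym2 V → ℕ) (B L Δ₀ : ℕ) (t : ℝ) (j m : ℕ)
    (a : AState V) : Prop where
  inv : a.Inv G w (j * B)
  card_uncovered : a.uncovered.card * 2 ^ j ≤ Fintype.card V
  card_centers : (a.centers.card : ℝ) ≤ j * t
  threshold : m = 0 ∨ Δ₀ * 2 ^ m ≤ B
  length_trace : a.trace.length ≤ (j + m) * L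
  le_of_mem_trace : ∀ x ∈ a.trace, x ≤ B

/-- The properties of the output of CLUSTER that hold with high probability. -/
def IsGoodCluster (G : SimpleGraph V) (w : Sym2 V → ℕ) (B L Δ₀ J : ℕ) (W : ℝ)
    (c : V → V) (tr : List ℕ) : Prop :=
  ((Finset.univ.image c).card : ℝ) ≤ W ∧ radius G w c ≤ J * B ∧
    (∃ m, (m = 0 ∨ Δ₀ * 2 ^ m ≤ B) ∧ tr.length ≤ (J + m) * L) ∧ ∀ x ∈ tr, x ≤ B

/-- The term `J * t` pays for the centers selected in the stages, and `b` for the singleton clusters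
made of the uncovered nodes at the end. -/
lemma ClusterInv.isGoodCluster {B L Δ₀ J j m : ℕ} {t b : ℝ} (ht : 0 ≤ t)
    (ha : ClusterInv G w B L Δ₀ t j m a) (hj : j ≤ J) (hb : (a.uncovered.card : ℝ) ≤ b) :
    IsGoodCluster G w B L Δ₀ J (J * t + b) (fun v => (a.asg v).untopD v) a.trace := by
  have hj' : (j : ℝ) ≤ J := by exact_mod_cast hj
  refine ⟨?_, ?_, ⟨m, ha.threshold, ha.length_trace.trans (by gcongr)⟩, ha.le_of_mem_trace⟩
  · have hsub : (Finset.univ.image fun v => (a.asg v).untopD v) ⊆ a.centers ∪ a.uncovered := by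
      intro x hx
      obtain ⟨v, -, rfl⟩ := Finset.mem_image.1 hx
      by_cases hv : v ∈ a.uncovered
      · rw [ha.inv.asg_uncovered v hv]
        exact Finset.mem_union_right _ hv
      · obtain ⟨x, hx, hxc, -⟩ := ha.inv.asg_covered v hv
        rw [hxc]
        exact Finset.mem_union_left _ hx
    have hcard : ((Finset.univ.image fun v => (a.asg v).untopD v).card : ℝ) ≤
        a.centers.card + a.uncovered.card := by
      exact_mod_cast (Finset.card_le_card hsub).trans (Finset.card_union_le _ _)
    nlinarith [ha.card_centers, mul_le_mul_of_nonneg_right hj' ht]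
  · refine Finset.sup_le fun v _ => ?_
    by_cases hv : v ∈ a.uncovered
    · simp [ha.inv.asg_uncovered v hv]
    · obtain ⟨x, hx, hxc, hxv⟩ := ha.inv.asg_covered v hv
      simp only [hxc, WithTop.untopD_coe]
      exact hxv.trans (by gcongr)

/-- Every stage of CLUSTER adds at most the failure probability of its random selection. -/
lemma clusterLoop_compl_le (hG : G.Connected) (hw : ∀ e ∈ G.edgeSet, 1 ≤ w e)
    (hn : 2 ≤ Fintype.card V) {τ : ℕ} (hτ : 1 ≤ τ) {c : V → V}
    (hc : (Finset.univ.image c).card ≤ τ) {N B Δ₀ J : ℕ}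
    (hB : B = 4 * radius G w c) (hJ : J = Nat.log 2 (Fintype.card V)) (hΔ₀ : 1 ≤ Δ₀)
    (hΔ₀B : 8 * (τ : ℝ) * Real.logb 2 (Fintype.card V) ≤ Fintype.card V → Δ₀ ≤ B)
    (hN : ell G w B + 2 ≤ N) (hN' : B < N) (M : ℕ) {j m : ℕ} (hj : j ≤ J) (hM : J ≤ j + M)
    (ha : ClusterInv G w B (ell G w B + 2) Δ₀ (6 * τ * Real.logb 2 (Fintype.card V)) j m a) :
    (clusterLoop N τ (M + 1) (Δ₀ * 2 ^ m) a).toOuterMeasure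
      {o | ∃ c tr, o = some (c, tr) ∧ IsGoodCluster G w B (ell G w B + 2) Δ₀ J
        (J * (6 * τ * Real.logb 2 (Fintype.card V)) +
          8 * τ * Real.logb 2 (Fintype.card V)) c tr}ᶜ ≤
      (J - j : ℕ) * (2 * τ * ENNReal.ofReal (Real.exp (-(2 * Real.log (Fintype.card V))))) := by
  have hn' : (2 : ℝ) ≤ Fintype.card V := by exact_mod_cast hn
  have hlg1 : 1 ≤ Real.logb 2 (Fintype.card V) := by
    rw [Real.le_logb_iff_rpow_le one_lt_two (by linarith)]
    simpa using hn'
  have hτ' : (1 : ℝ) ≤ τ := by exact_mod_cast hτ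
  have hexit : ∀ {a : AState V} {j m : ℕ}, j ≤ J →
      ClusterInv G w B (ell G w B + 2) Δ₀ (6 * τ * Real.logb 2 (Fintype.card V)) j m a →
      ¬ 8 * (τ : ℝ) * Real.logb 2 (Fintype.card V) ≤ a.uncovered.card →
      (PMF.pure (some (fun v => (a.asg v).untopD v, a.trace))).toOuterMeasure
        {o | ∃ c tr, o = some (c, tr) ∧ IsGoodCluster G w B (ell G w B + 2) Δ₀ J
          (J * (6 * τ * Real.logb 2 (Fintype.card V)) +
            8 * τ * Real.logb 2 (Fintype.card V)) c tr}ᶜ = 0 := by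
    intro a j m hj ha hcond
    classical
    rw [PMF.toOuterMeasure_pure_apply, if_neg]
    rw [Set.notMem_compl_iff]
    exact ⟨_, _, rfl, ha.isGoodCluster (by positivity) hj (not_le.1 hcond).le⟩
  -- A stage begins with at least 8 uncovered nodes, and these have been halved `j` times, so `8 * 2
  -- ^ j ≤ n`. Hence there are at most `J` stages.
  have hlt : ∀ {a : AState V} {j m : ℕ},
      ClusterInv G w B (ell G w B + 2) Δ₀ (6 * τ * Real.logb 2 (Fintype.card V)) j m a →
      8 * (τ : ℝ) * Real.logb 2 (Fintype.card V) ≤ a.uncovered.card → j + 1 ≤ J := by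
    intro a j m ha hcond
    have h8 : (8 : ℝ) ≤ a.uncovered.card := by nlinarith
    have h8' : 8 ≤ a.uncovered.card := by exact_mod_cast h8
    rw [hJ]
    refine Nat.le_log_of_pow_le one_lt_two ?_
    have := ha.card_uncovered
    have h2 : 8 * 2 ^ j ≤ a.uncovered.card * 2 ^ j := Nat.mul_le_mul_right _ h8'
    rw [pow_succ]
    omega
  induction M generalizing a j m with
  | zero =>
    rw [clusterLoop]
    split_ifs with hcond
    · have := hlt ha hcond
      omega
    · exact (hexit hj ha hcond).trans_le zero_le
  | succ M ih =>
    rw [clusterLoop]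
    split_ifs with hcond
    swap
    · exact (hexit hj ha hcond).trans_le zero_le
    have hj1 := hlt ha hcond
    have hsum : J - j = 1 + (J - (j + 1)) := by omega
    rw [hsum, Nat.cast_add, Nat.cast_one, add_mul, one_mul]
    refine toOuterMeasure_bind_compl_le _ _ _ _
      (select_cluster_stage_le (w := w) hG hn hτ hc hcond) ?_
    rintro S ⟨hS, hScard, hhalf⟩
    rw [Set.mem_ofPred_eq] at hS hScard hhalf
    have hΔB : Δ₀ * 2 ^ m ≤ B := by
      rcases ha.threshold with rfl | h
      · rw [pow_zero, mul_one]
        refine hΔ₀B (hcond.trans ?_)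
        exact_mod_cast Finset.card_le_univ _
      · exact h
    -- The budget `N` suffices for the doublings to reach the radius `2 * radius G w c` of the balls
    -- to be covered.
    have hpow : 2 * radius G w c ≤ Δ₀ * 2 ^ m * 2 ^ (N - 1) := by
      calc 2 * radius G w c ≤ N - 1 := by omega
        _ ≤ 2 ^ (N - 1) := Nat.lt_two_pow_self.le
        _ ≤ _ := Nat.le_mul_of_pos_left _ (by positivity)
    obtain ⟨s, m', tr, h1, h2, h3, h4, h5, h6⟩ := exists_innerLoop_eq hG hw ha.inv hS hN
      (by omega) hhalf (N - 1) (Reachable.initState ha.inv hS) hΔB hpow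
    rw [Nat.sub_add_cancel (by omega)] at h1
    have hpow' : Δ₀ * 2 ^ m * 2 ^ m' = Δ₀ * 2 ^ (m + m') := by ring
    rw [hpow'] at h1 h2 h3 h4
    simp only [h1]
    have hinv := ha.inv.contract hG hw hS h2 (a.trace ++ tr)
    have hunc := h2.uncovered_nextState a.graph.wt (a.trace ++ tr)
    refine ih (a := nextState a S (Δ₀ * 2 ^ (m + m')) s a.graph.wt (a.trace ++ tr))
      (j := j + 1) (m := m + m') hj1 (by omega) ⟨hinv.mono ?_, ?_, ?_, Or.inr h3, ?_, ?_⟩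
    · rw [add_mul, one_mul]
      omega
    · rw [hunc]
      have hcard := Finset.card_sdiff_add_card_eq_card
        (fun v hv => (mem_reached.1 hv).1 :
          reached a.uncovered (Δ₀ * 2 ^ (m + m')) s ⊆ a.uncovered)
      refine le_trans ?_ ha.card_uncovered
      rw [pow_succ, mul_comm (2 ^ j) 2, ← mul_assoc]
      refine Nat.mul_le_mul_right _ ?_
      omega
    · have hle : ((a.centers ∪ S).card : ℝ) ≤ a.centers.card + S.card := by
        exact_mod_cast Finset.card_union_le _ _
      refine hle.trans ?_
      push_cast
      linarith [ha.card_centers]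
    · simp only [nextState, List.length_append]
      have := ha.length_trace
      calc _ ≤ (j + m) * (ell G w B + 2) + (m' + 1) * (ell G w B + 2) := add_le_add this h5
        _ = _ := by ring
    · intro x hx
      rcases List.mem_append.1 hx with hx | hx
      · exact ha.le_of_mem_trace x hx
      · exact h6 x hx

/-- CLUSTER has a good output with high probability. -/
lemma cluster_compl_le (hG : G.Connected) (hw : ∀ e ∈ G.edgeSet, 1 ≤ w e)
    (hn : 2 ≤ Fintype.card V) {τ : ℕ} (hτ : 1 ≤ τ) {c : V → V}
    (hc : (Finset.univ.image c).card ≤ τ) {N B Δ₀ J : ℕ}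
    (hB : B = 4 * radius G w c) (hJ : J = Nat.log 2 (Fintype.card V))
    (hΔ₀ : Δ₀ = sInf (w '' G.edgeSet)) (hΔ₀1 : 1 ≤ Δ₀)
    (hΔ₀B : 8 * (τ : ℝ) * Real.logb 2 (Fintype.card V) ≤ Fintype.card V → Δ₀ ≤ B)
    (hN : ell G w B + 2 ≤ N) (hN' : B < N) (hJN : J < N) :
    (cluster N G w τ).toOuterMeasure
      {o | ∃ c tr, o = some (c, tr) ∧ IsGoodCluster G w B (ell G w B + 2) Δ₀ J
        (J * (6 * τ * Real.logb 2 (Fintype.card V)) +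
          8 * τ * Real.logb 2 (Fintype.card V)) c tr}ᶜ ≤
      ENNReal.ofReal (1 / (4 * Fintype.card V)) := by
  have hn' : (2 : ℝ) ≤ Fintype.card V := by exact_mod_cast hn
  have hτ' : (1 : ℝ) ≤ τ := by exact_mod_cast hτ
  have hlg1 : 1 ≤ Real.logb 2 (Fintype.card V) := by
    rw [Real.le_logb_iff_rpow_le one_lt_two (by linarith)]
    simpa using hn'
  have hunc : (AState.init G w).uncovered = Finset.univ := uncovered_init []
  have hinit : ClusterInv G w B (ell G w B + 2) Δ₀
      (6 * τ * Real.logb 2 (Fintype.card V)) 0 0 (AState.init G w) :=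
    ⟨(AState.Inv.init []).mono (by simp), by simp [hunc, Finset.card_univ],
      by simp [AState.init], Or.inl rfl, by simp [AState.init], by simp [AState.init]⟩
  by_cases hcond : 8 * (τ : ℝ) * Real.logb 2 (Fintype.card V) ≤ Fintype.card V
  · have h := clusterLoop_compl_le hG hw hn hτ hc hB hJ hΔ₀1 hΔ₀B hN hN' (N - 1) (Nat.zero_le J)
      (by omega) hinit
    rw [Nat.sub_add_cancel (by omega), pow_zero, mul_one, Nat.sub_zero] at h
    rw [cluster, ← hΔ₀]
    refine h.trans ?_
    have hJ' : (J : ℝ) ≤ Real.logb 2 (Fintype.card V) := by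
      rw [hJ]
      exact Real.natLog_le_logb _ _
    rw [← ENNReal.ofReal_natCast J, ← ENNReal.ofReal_natCast τ,
      show (2 : ℝ≥0∞) = ENNReal.ofReal 2 by simp, ← ENNReal.ofReal_mul (by norm_num),
      ← ENNReal.ofReal_mul (by positivity), ← ENNReal.ofReal_mul (by positivity)]
    refine ENNReal.ofReal_le_ofReal ?_
    have hexp : Real.exp (-(2 * Real.log (Fintype.card V))) = 1 / (Fintype.card V : ℝ) ^ 2 := by
      rw [Real.exp_neg, two_mul, Real.exp_add, Real.exp_log (by linarith), one_div, sq]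
    rw [hexp]
    -- The union bound over the stages gives at most `2 τ log n / n²`, and the loop condition `8 τ
    -- log n ≤ n` turns this into `1 / (4 n)`.
    calc _ ≤ Real.logb 2 (Fintype.card V) * (2 * τ * (1 / (Fintype.card V : ℝ) ^ 2)) := by
          gcongr
      _ = (8 * (τ : ℝ) * Real.logb 2 (Fintype.card V)) * (1 / (4 * (Fintype.card V : ℝ) ^ 2)) := by
          field_simp
          norm_num
      _ ≤ Fintype.card V * (1 / (4 * (Fintype.card V : ℝ) ^ 2)) := by gcongr
      _ = _ := by field_simp
  -- Here the loop is never entered and the output consists of singletons, with certainty.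
  · rw [cluster, ← Nat.sub_add_cancel (by omega : 1 ≤ N), clusterLoop, hunc, Finset.card_univ,
      if_neg hcond]
    classical
    rw [PMF.toOuterMeasure_pure_apply, if_neg]
    · exact zero_le
    · rw [Set.notMem_compl_iff]
      refine ⟨_, _, rfl, hinit.isGoodCluster (by positivity) (Nat.zero_le _) ?_⟩
      rw [hunc, Finset.card_univ]
      exact (not_le.1 hcond).le

end Cluster

/-! ### Analysis of CLUSTER2. -/

section Cluster2

variable {V : Type*} [Fintype V] [LinearOrder V] {G : SimpleGraph V} {w : Sym2 V → ℕ}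

/-- The failure probability of the random selection in an iteration of CLUSTER2. -/
lemma select_cluster2_iter_le (hG : G.Connected) (hn : 2 ≤ Fintype.card V) {c : V → V} {W : ℕ}
    (hW : 1 ≤ W) (hc : (Finset.univ.image c).card ≤ W) {A : ℝ}
    (hA : A = 16 * W * Real.log (Fintype.card V)) {U : Finset V} {i : ℕ}
    (hU : U.card * 2 ^ i ≤ Fintype.card V * A) :
    (select U (2 ^ (i + 1) / (Fintype.card V : ℝ≥0∞))).toOuterMeasure
      ({S | S ⊆ U} ∩ ({S | (S.card : ℝ) ≤ 6 * A} ∩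
        ({S | Fintype.card V ≤ 2 ^ (i + 1) → S = U} ∩
        {S | U.card * 2 ^ (i + 1) ≤ Fintype.card V * A ∨ Fintype.card V ≤ 2 ^ (i + 1) ∨
          U.card ≤ 2 * (ballNodes G w U S (2 * radius G w c)).card})))ᶜ ≤
      (W + 1) * ENNReal.ofReal (Real.exp (-(8 * Real.log (Fintype.card V)))) := by
  have hn' : (2 : ℝ) ≤ Fintype.card V := by exact_mod_cast hn
  have hn0 : (0 : ℝ) < Fintype.card V := by linarith
  have hln : 0 < Real.log (Fintype.card V) := Real.log_pos (by linarith)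
  have hW' : (1 : ℝ) ≤ W := by exact_mod_cast hW
  have hA1 : 16 * Real.log (Fintype.card V) ≤ A := by
    rw [hA]
    nlinarith
  set p : ℝ≥0∞ := 2 ^ (i + 1) / (Fintype.card V : ℝ≥0∞) with hp
  have hpt : p.toReal = 2 ^ (i + 1) / Fintype.card V := by
    rw [hp, ENNReal.toReal_div, ENNReal.toReal_pow, ENNReal.toReal_natCast, ENNReal.toReal_ofNat]
  have hptop : p ≠ ⊤ := by
    refine ENNReal.div_ne_top (by simp) ?_
    exact_mod_cast (by omega : Fintype.card V ≠ 0)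
  have hp1 : 1 ≤ p ↔ Fintype.card V ≤ 2 ^ (i + 1) := by
    rw [← ENNReal.toReal_le_toReal ENNReal.one_ne_top hptop, hpt, ENNReal.toReal_one,
      one_le_div hn0]
    exact_mod_cast Iff.rfl
  have h1 := select_not_subset U p
  have h2 : (select U p).toOuterMeasure {S | (S.card : ℝ) ≤ 6 * A}ᶜ ≤
      ENNReal.ofReal (Real.exp (-(8 * Real.log (Fintype.card V)))) := by
    refine (select_card_gt_le U p (6 * A)).trans
      (ENNReal.ofReal_le_ofReal (Real.exp_le_exp.2 ?_))
    have hq : (min p 1).toReal * U.card ≤ 2 * A := by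
      calc (min p 1).toReal * U.card ≤ p.toReal * U.card := by
            gcongr
            exact min_le_left _ _
        _ = (U.card * 2 ^ i) * (2 / Fintype.card V) := by
            rw [hpt, pow_succ]
            field_simp
        _ ≤ (Fintype.card V * A) * (2 / Fintype.card V) := by gcongr
        _ = 2 * A := by field_simp
    -- At most `2 A` nodes are selected on average, and `6 A ln 2 - 2 A` exceeds `A / 2 ≥ 8 ln n`.
    nlinarith [Real.log_two_gt_d9]
  have h3 : (select U p).toOuterMeasure {S | Fintype.card V ≤ 2 ^ (i + 1) → S = U}ᶜ = 0 := by
    by_cases h : Fintype.card V ≤ 2 ^ (i + 1)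
    · simpa only [h, true_imp_iff] using select_ne_self (hp1.2 h)
    · simp [h]
  have h4 : (select U p).toOuterMeasure {S | U.card * 2 ^ (i + 1) ≤ Fintype.card V * A ∨
      Fintype.card V ≤ 2 ^ (i + 1) ∨
        U.card ≤ 2 * (ballNodes G w U S (2 * radius G w c)).card}ᶜ ≤
      W * ENNReal.ofReal (Real.exp (-(8 * Real.log (Fintype.card V)))) := by
    by_cases ha : U.card * 2 ^ (i + 1) ≤ Fintype.card V * A
    · simp [ha]
    by_cases hb : Fintype.card V ≤ 2 ^ (i + 1)
    · simp [hb]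
    simp only [ha, hb, false_or]
    refine select_ballNodes_le (w := w) hG c hc p ?_
    rw [min_eq_left (not_le.1 fun h => hb (hp1.1 h)).le, hpt]
    rw [not_le] at ha
    -- When the next bound on `U` is not met yet, more than `A = 2 W · 8 ln n` nodes are selected on
    -- average, enough to hit half of `U`.
    calc 2 * W * (8 * Real.log (Fintype.card V)) = (Fintype.card V * A) / Fintype.card V := by
          rw [hA]
          field_simp
          norm_num
      _ ≤ (U.card * 2 ^ (i + 1)) / Fintype.card V := by gcongr
      _ = _ := by ring
  refine (toOuterMeasure_inter_compl_le _ _ _ h1.le (toOuterMeasure_inter_compl_le _ _ _ h2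
    (toOuterMeasure_inter_compl_le _ _ _ h3.le h4))).trans_eq ?_
  ring

/-- The invariant of the loop of CLUSTER2 after `i` iterations. -/
structure Cluster2Inv (G : SimpleGraph V) (w : Sym2 V → ℕ) (Δ L T B : ℕ) (A : ℝ) (i : ℕ)
    (a : AState V) : Prop where
  inv : a.Inv G w (i * Δ)
  card_uncovered : a.uncovered.card * 2 ^ i ≤ Fintype.card V * A
  card_centers : (a.centers.card : ℝ) ≤ i * (6 * A)
  length_trace : a.trace.length ≤ T + i * L
  le_of_mem_trace : ∀ x ∈ a.trace, x ≤ B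
  uncovered_eq_empty : 1 ≤ i → Fintype.card V ≤ 2 ^ i → a.uncovered = ∅

/-- The bound `|U| 2^i ≤ n A` survives an iteration for one of three reasons: `U` is already small
enough, all of `U` is selected, or half of `U` lies within twice the radius of `c` from new centers.
That distance is the threshold, so this half gets covered. -/
lemma cluster2Loop_compl_le (hG : G.Connected) (hw : ∀ e ∈ G.edgeSet, 1 ≤ w e)
    (hn : 2 ≤ Fintype.card V) {c : V → V} {W : ℕ} (hW : 1 ≤ W)
    (hc : (Finset.univ.image c).card ≤ W) {A : ℝ}
    (hA : A = 16 * W * Real.log (Fintype.card V)) {N L T B : ℕ}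
    (hL : ell G w (2 * radius G w c : ℕ) + 2 ≤ L) (hLN : L ≤ N) (hB : 2 * radius G w c ≤ B)
    {a : AState V} (ha : Cluster2Inv G w (2 * radius G w c) L T B A 0 a) (i : ℕ) :
    (cluster2Loop N (2 * radius G w c) a i).toOuterMeasure
      {o | ∃ a', o = some a' ∧ Cluster2Inv G w (2 * radius G w c) L T B A i a'}ᶜ ≤
      i * ((W + 1) * ENNReal.ofReal (Real.exp (-(8 * Real.log (Fintype.card V))))) := by
  classical
  induction i with
  | zero =>
    rw [cluster2Loop, PMF.toOuterMeasure_pure_apply, if_neg]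
    · exact zero_le
    · rw [Set.notMem_compl_iff]
      exact ⟨a, rfl, ha⟩
  | succ i ih =>
    rw [cluster2Loop, Nat.cast_succ, add_mul, one_mul]
    refine toOuterMeasure_bind_compl_le _ _ _ _ ih ?_
    rintro o ⟨a, rfl, ha⟩
    dsimp only
    -- After a good selection the iteration is deterministic, so its second part fails with
    -- probability 0.
    rw [cluster2Iter, ← add_zero ((W + 1 : ℝ≥0∞) * _)]
    refine toOuterMeasure_bind_compl_le _ _ _ _
      (select_cluster2_iter_le (w := w) hG hn hW hc hA ha.card_uncovered) ?_
    rintro S ⟨hS, hScard, hSU, hhalf⟩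
    rw [Set.mem_ofPred_eq] at hS hScard hSU hhalf
    set Δ := 2 * radius G w c with hΔ
    obtain ⟨s, j, h1, h2, h3, h4⟩ := (Reachable.initState (Δ := Δ) ha.inv hS).exists_growUntil_eq
      hG hw ha.inv (fun _ => False) (hL.trans hLN)
    rw [or_false] at h4
    rw [partialGrowth2, h1]
    dsimp only
    rw [PMF.toOuterMeasure_pure_apply, if_neg]
    rw [Set.notMem_compl_iff]
    have hinv := ha.inv.contract2 hG hw hS h3 h4 (a.trace ++ List.replicate j Δ)
    have hunc := h3.uncovered_nextState
      (fun u v => if a.graph.wt u v ≤ Δ then s.d u + a.graph.wt u v - Δ else a.graph.wt u v)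
      (a.trace ++ List.replicate j Δ)
    refine ⟨_, rfl, ?_⟩
    change Cluster2Inv G w Δ L T B A (i + 1) (nextState a S Δ s
      (fun u v => if a.graph.wt u v ≤ Δ then s.d u + a.graph.wt u v - Δ else a.graph.wt u v)
      (a.trace ++ List.replicate j Δ))
    have hempty : Fintype.card V ≤ 2 ^ (i + 1) →
        a.uncovered \ reached a.uncovered Δ s = ∅ := by
      intro h
      -- With selection probability 1 every uncovered node becomes a center, and centers have value
      -- 0.
      rw [Finset.sdiff_eq_empty_iff_subset, ← hSU h]
      intro x hx
      refine mem_reached.2 ⟨hx, ?_⟩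
      rw [(h3.center x (Finset.mem_union_right _ hx)).1]
      exact zero_le
    have hA0 : 0 ≤ A := by
      rw [hA]
      have : 0 ≤ Real.log (Fintype.card V) := Real.log_natCast_nonneg _
      positivity
    refine ⟨by rw [add_mul, one_mul]; exact hinv, ?_, ?_, ?_, ?_, fun _ h => by
      rw [hunc, hempty h]⟩
    · rw [hunc]
      rcases hhalf with h | h | h
      · refine le_trans ?_ h
        gcongr
        exact Finset.sdiff_subset
      · rw [hempty h, Finset.card_empty]
        simp only [Nat.cast_zero, zero_mul]
        positivity
      · have hcard : (a.uncovered \ reached a.uncovered Δ s).card +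
            (reached a.uncovered Δ s).card = a.uncovered.card :=
          Finset.card_sdiff_add_card_eq_card fun v hv => (mem_reached.1 hv).1
        have hball := Finset.card_le_card (h3.ballNodes_subset hG hw ha.inv hS h4 le_rfl)
        have h5 : (a.uncovered \ reached a.uncovered Δ s).card * 2 ≤ a.uncovered.card := by
          omega
        have h6 : ((a.uncovered \ reached a.uncovered Δ s).card : ℝ) * 2 ≤ a.uncovered.card := by
          exact_mod_cast h5
        refine le_trans ?_ ha.card_uncovered
        rw [pow_succ, mul_comm (2 ^ i) (2 : ℝ), ← mul_assoc]
        gcongr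
    · have hle : ((a.centers ∪ S).card : ℝ) ≤ a.centers.card + S.card := by
        exact_mod_cast Finset.card_union_le _ _
      refine hle.trans ?_
      push_cast
      linarith [ha.card_centers]
    · simp only [nextState, List.length_append, List.length_replicate]
      have := ha.length_trace
      rw [add_mul, one_mul]
      omega
    · intro x hx
      rcases List.mem_append.1 hx with hx | hx
      · exact ha.le_of_mem_trace x hx
      · exact (List.eq_of_mem_replicate hx).trans_le hB

/-- When all nodes are covered, the assignment is a clustering. -/
lemma AState.Inv.exists_clustering {ρ : ℕ} {a : AState V} (ha : a.Inv G w ρ)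
    (hU : a.uncovered = ∅) :
    ∃ K c, (∀ v, a.asg v = (c v : WithTop V)) ∧ IsClustering K c ∧ K ≤ a.centers.card ∧
      radius G w c ≤ ρ := by
  have h := fun v => ha.asg_covered v (by simp [hU])
  choose c hc hasg hdist using h
  refine ⟨_, c, hasg, ⟨fun v => ?_, rfl⟩, Finset.card_le_card ?_, Finset.sup_le fun v _ => hdist v⟩
  · have := ha.asg_center (c v) (hc v)
    rw [hasg (c v)] at this
    exact WithTop.coe_injective this
  · intro x hx
    simp only [Finset.mem_image] at hx
    obtain ⟨v, -, rfl⟩ := hx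
    exact hc v

end Cluster2

/-! ### Optimal clusterings, and the two algorithms combined. -/

section Main

variable {V : Type*} [Fintype V] [LinearOrder V] {G : SimpleGraph V} {w : Sym2 V → ℕ}

lemma exists_adj_of_two_le_card (hG : G.Connected) (hn : 2 ≤ Fintype.card V) :
    G.edgeSet.Nonempty := by
  obtain ⟨u, v, huv⟩ := Fintype.exists_pair_of_one_lt_card (by omega : 1 < Fintype.card V)
  obtain ⟨p⟩ := hG.preconnected u v
  cases p with
  | nil => exact absurd rfl huv
  | cons h q => exact ⟨s(_, _), h⟩

/-- If the radius were smaller than every edge weight, each node would be its own center. This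
compares the initial threshold of CLUSTER with the optimal radius when `τ < n`. -/
lemma le_radius_of_card_lt (hG : G.Connected) {m : ℕ} (hw : ∀ e ∈ G.edgeSet, m ≤ w e)
    {c : V → V} (hc : (Finset.univ.image c).card < Fintype.card V) : m ≤ radius G w c := by
  by_contra hlt
  have hid : ∀ v, c v = v := fun v => by
    by_contra hv
    exact hlt ((le_wdist_of_ne hG hw hv).trans (wdist_le_radius c v))
  have : Finset.univ.image c = Finset.univ :=
    Finset.eq_univ_of_forall fun v => Finset.mem_image.2 ⟨v, Finset.mem_univ v, hid v⟩
  rw [this, Finset.card_univ] at hc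
  exact lt_irrefl _ hc

lemma radius_le_card_mul (hG : G.Connected) {m : ℕ} (hw : ∀ e ∈ G.edgeSet, w e ≤ m) (c : V → V) :
    radius G w c ≤ Fintype.card V * m :=
  Finset.sup_le fun _ _ => wdist_le_card_mul hG hw _ _

/-- The infimum is attained because some clustering exists: any `τ` nodes serve as centers, and all
other nodes join one of them. -/
lemma exists_optRadius_eq {τ : ℕ} (hτ : 1 ≤ τ) (hτn : τ ≤ Fintype.card V) :
    ∃ c : V → V, (Finset.univ.image c).card = τ ∧ radius G w c = optRadius G w τ := by
  have hne : {r | ∃ c : V → V, IsClustering τ c ∧ radius G w c = r}.Nonempty := by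
    obtain ⟨T, -, hT⟩ := Finset.exists_subset_card_eq (s := (Finset.univ : Finset V)) (n := τ)
      (by rwa [Finset.card_univ])
    obtain ⟨x, hx⟩ : T.Nonempty := Finset.card_pos.1 (by omega)
    have hmem : ∀ v, (if v ∈ T then v else x) ∈ T := fun v => by
      split_ifs with h
      exacts [h, hx]
    refine ⟨_, fun v => if v ∈ T then v else x, ⟨fun v => if_pos (hmem v), ?_⟩, rfl⟩
    rw [← hT]
    congr 1
    ext y
    simp only [Finset.mem_image, Finset.mem_univ, true_and]
    constructor
    · rintro ⟨v, rfl⟩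
      exact hmem v
    · exact fun hy => ⟨y, if_pos hy⟩
  obtain ⟨c, ⟨-, hc⟩, hr⟩ := Nat.sInf_mem hne
  refine ⟨c, ?_, hr⟩
  convert hc

/-- One sufficiently large budget is enough, since the supremum dominates its value there. -/
lemma cluster2Prob_ge (N : ℕ) {τ : ℕ} {P : (V → WithTop V) → List ℕ → Prop} {ε : ℝ}
    (hε : 0 ≤ ε) (h : (cluster2 N G w τ).toOuterMeasure
      {o | ∃ asg tr, o = some (asg, tr) ∧ P asg tr}ᶜ ≤ ENNReal.ofReal ε) :
    ENNReal.ofReal (1 - ε) ≤ cluster2Prob G w τ P := by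
  rw [ENNReal.ofReal_sub _ hε, ENNReal.ofReal_one]
  exact (one_sub_le_toOuterMeasure _ h).trans (le_iSup (fun N => (cluster2 N G w τ).toOuterMeasure
    {o | ∃ asg tr, o = some (asg, tr) ∧ P asg tr}) N)

/-- The guarantees of CLUSTER2, in terms of an optimal clustering `c`. -/
lemma cluster2_compl_le (hG : G.Connected) (hw : ∀ e ∈ G.edgeSet, 1 ≤ w e)
    (hn : 2 ≤ Fintype.card V) {τ : ℕ} (hτ : 1 ≤ τ) {c : V → V}
    (hc : (Finset.univ.image c).card = τ) {N B Δ₀ J L : ℕ}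
    (hJ : J = Nat.log 2 (Fintype.card V)) (hΔ₀ : Δ₀ = sInf (w '' G.edgeSet))
    (hB : B = 8 * J * radius G w c) (hL : L = ell G w B + 2)
    (hN : L ≤ N) (hN' : B < N) (hJN : J < N) :
    (cluster2 N G w τ).toOuterMeasure
      {o | ∃ asg tr, o = some (asg, tr) ∧
        ((∃ K c', (∀ v, asg v = (c' v : WithTop V)) ∧ IsClustering K c' ∧
          (K : ℝ) ≤ 2688 * τ * Real.logb 2 (Fintype.card V) ^ 4 ∧
          radius G w c' ≤ 16 * J ^ 2 * radius G w c) ∧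
        (∃ m, (m = 0 ∨ Δ₀ * 2 ^ m ≤ B) ∧ tr.length ≤ (3 * J + m) * L) ∧ ∀ x ∈ tr, x ≤ B)}ᶜ ≤
      ENNReal.ofReal (1 / Fintype.card V) := by
  have hn' : (2 : ℝ) ≤ Fintype.card V := by exact_mod_cast hn
  have hτ' : (1 : ℝ) ≤ τ := by exact_mod_cast hτ
  set lg := Real.logb 2 (Fintype.card V) with hlg
  have hlg1 : 1 ≤ lg := by
    rw [hlg, Real.le_logb_iff_rpow_le one_lt_two (by linarith)]
    simpa using hn'
  have hln : Real.log (Fintype.card V) ≤ lg := by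
    have h1 : Real.log (Fintype.card V) = Real.log 2 * lg := by
      rw [hlg, Real.logb]
      field_simp
    nlinarith [Real.log_two_lt_d9]
  have hln0 : 0 < Real.log (Fintype.card V) := Real.log_pos (by linarith)
  have hln1 : 1 / 2 ≤ Real.log (Fintype.card V) := by
    have := Real.log_le_log zero_lt_two hn'
    linarith [Real.log_two_gt_d9]
  have hJlg : (J : ℝ) ≤ lg := by
    rw [hJ]
    exact Real.natLog_le_logb _ _
  have hJ1 : 1 ≤ J := by
    rw [hJ]
    exact Nat.log_pos one_lt_two hn
  have hI : Nat.clog 2 (Fintype.card V) ≤ 2 * J := by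
    have : Nat.clog 2 (Fintype.card V) ≤ J + 1 := by
      rw [hJ]
      exact Nat.clog_le_of_le_pow (Nat.lt_pow_succ_log_self one_lt_two _).le
    omega
  have hIn : Nat.clog 2 (Fintype.card V) ≤ Fintype.card V :=
    Nat.clog_le_of_le_pow Nat.lt_two_pow_self.le
  have hI1 : 1 ≤ Nat.clog 2 (Fintype.card V) := Nat.clog_pos one_lt_two hn
  have hne := exists_adj_of_two_le_card hG hn
  have hΔ₀1 : 1 ≤ Δ₀ := by
    obtain ⟨e, he, hee⟩ := Nat.sInf_mem (hne.image w)
    rw [hΔ₀, ← hee]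
    exact hw e he
  have hB4 : 4 * radius G w c ≤ B := by
    rw [hB]
    exact Nat.mul_le_mul_right _ (by omega)
  have hellB : ell G w (4 * radius G w c : ℕ) ≤ ell G w B :=
    ell_mono hG (by exact_mod_cast hB4)
  have hΔ₀B : 8 * (τ : ℝ) * lg ≤ Fintype.card V → Δ₀ ≤ 4 * radius G w c := by
    intro h
    have hlt : (τ : ℝ) < Fintype.card V := by nlinarith
    have := le_radius_of_card_lt hG (m := Δ₀)
      (fun e he => hΔ₀ ▸ Nat.sInf_le (Set.mem_image_of_mem w he))
      (hc ▸ (by exact_mod_cast hlt) : (Finset.univ.image c).card < Fintype.card V)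
    omega
  have hcl := cluster_compl_le hG hw hn hτ hc.le rfl hJ hΔ₀ hΔ₀1 hΔ₀B (N := N) (by omega)
    (by omega) hJN
  -- CLUSTER may fail with probability `1 / (4 n)`; the rest is left to the iterations of CLUSTER2.
  have hsplit : ENNReal.ofReal (1 / Fintype.card V) =
      ENNReal.ofReal (1 / (4 * Fintype.card V)) + ENNReal.ofReal (3 / (4 * Fintype.card V)) := by
    rw [← ENNReal.ofReal_add (by positivity) (by positivity)]
    congr 1
    field_simp
    norm_num
  rw [hsplit, cluster2]
  refine toOuterMeasure_bind_compl_le _ _ _ _ hcl ?_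
  rintro o ⟨c', tr, rfl, hW, hr, ⟨m, hm, htr⟩, htrB⟩
  dsimp only
  rw [PMF.toOuterMeasure_map_apply]
  set W := (Finset.univ.image c').card with hWdef
  have hW1 : 1 ≤ W := by
    have : Nonempty V := hG.nonempty
    exact Finset.card_pos.2 (Finset.univ_nonempty.image c')
  have hW1' : (1 : ℝ) ≤ W := by exact_mod_cast hW1
  have hWn : W ≤ Fintype.card V := Finset.card_le_univ _
  have hWn' : (W : ℝ) ≤ Fintype.card V := by exact_mod_cast hWn
  have hWlg : (W : ℝ) ≤ 14 * τ * lg ^ 2 := by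
    refine hW.trans ?_
    have h1 : (J : ℝ) * (6 * τ * lg) ≤ lg * (6 * τ * lg) := by gcongr
    have h2 : 8 * (τ : ℝ) * lg ≤ 8 * τ * lg * lg := le_mul_of_one_le_right (by positivity) hlg1
    nlinarith
  set A : ℝ := 16 * W * Real.log (Fintype.card V) with hA
  have hA1 : 1 ≤ A := by
    rw [hA]
    nlinarith
  -- CLUSTER returns a radius of at most `J` times `4 * radius G w c`; twice this is `B`.
  have hr2 : 2 * radius G w c' ≤ B := by
    rw [hB]
    nlinarith
  have hell2 : ell G w (2 * radius G w c' : ℕ) + 2 ≤ L := by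
    have : ell G w (2 * radius G w c' : ℕ) ≤ ell G w B := ell_mono hG (by exact_mod_cast hr2)
    omega
  have hinit : Cluster2Inv G w (2 * radius G w c') L ((J + m) * L) B A 0
      { AState.init G w with trace := tr } := by
    refine ⟨(AState.Inv.init tr).mono (by simp), ?_, by simp [AState.init], ?_,
      fun x hx => (htrB x hx).trans hB4, by omega⟩
    · rw [uncovered_init, Finset.card_univ, pow_zero]
      gcongr
    · rw [zero_mul, add_zero]
      exact htr.trans (Nat.mul_le_mul_left _ (by omega))
  have hloop := cluster2Loop_compl_le hG hw hn hW1 hWdef.ge hA hell2 hN hr2 hinit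
    (Nat.clog 2 (Fintype.card V))
  refine le_trans (MeasureTheory.measure_mono ?_) (hloop.trans ?_)
  · rw [Set.preimage_compl, Set.compl_subset_compl]
    rintro o ⟨a, rfl, ha⟩
    obtain ⟨K, c'', hasg, hcl, hK, hrad⟩ := ha.inv.exists_clustering
      (ha.uncovered_eq_empty hI1 (Nat.le_pow_clog one_lt_two _))
    refine ⟨a.asg, a.trace, rfl, ⟨K, c'', hasg, hcl, ?_, ?_⟩, ⟨m, ?_, ?_⟩, ha.le_of_mem_trace⟩
    · have hK' : (K : ℝ) ≤ a.centers.card := by exact_mod_cast hK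
      have hI' : (Nat.clog 2 (Fintype.card V) : ℝ) ≤ 2 * lg := by
        have : (Nat.clog 2 (Fintype.card V) : ℝ) ≤ 2 * J := by exact_mod_cast hI
        linarith
      -- At most `2 log n` iterations contribute `6 A` centers each, with `A ≤ 16 · 14 τ log² n ·
      -- log n`; and `2 · 6 · 16 · 14 = 2688`.
      calc (K : ℝ) ≤ (Nat.clog 2 (Fintype.card V)) * (6 * A) := hK'.trans ha.card_centers
        _ ≤ (2 * lg) * (6 * (16 * (14 * τ * lg ^ 2) * lg)) := by
            rw [hA]
            gcongr
        _ = _ := by ring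
    · calc radius G w c'' ≤ Nat.clog 2 (Fintype.card V) * (2 * radius G w c') := hrad
        _ ≤ (2 * J) * (2 * (J * (4 * radius G w c))) := by gcongr
        _ = _ := by ring
    · rcases hm with h | h
      · exact Or.inl h
      · exact Or.inr (h.trans hB4)
    · refine ha.length_trace.trans ?_
      calc _ ≤ (J + m) * L + 2 * J * L := by gcongr
        _ = _ := by ring
  · rw [← ENNReal.ofReal_natCast (Nat.clog 2 _), ← ENNReal.ofReal_natCast W,
      ← ENNReal.ofReal_one, ← ENNReal.ofReal_add (by positivity) zero_le_one,
      ← ENNReal.ofReal_mul (by positivity), ← ENNReal.ofReal_mul (by positivity)]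
    refine ENNReal.ofReal_le_ofReal ?_
    have hexp : Real.exp (-(8 * Real.log (Fintype.card V))) = 1 / (Fintype.card V : ℝ) ^ 8 := by
      rw [Real.exp_neg, show (8 : ℝ) = (8 : ℕ) by norm_num, Real.exp_nat_mul,
        Real.exp_log (by linarith), one_div]
    rw [hexp]
    have hIn' : (Nat.clog 2 (Fintype.card V) : ℝ) ≤ Fintype.card V := by exact_mod_cast hIn
    set n : ℝ := ((Fintype.card V : ℕ) : ℝ) with hnr
    have hn0 : 0 < n := by linarith
    calc _ ≤ n * ((n + n) * (1 / n ^ 8)) := by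
          gcongr
          linarith
      _ = (8 / 3) / n ^ 5 * (3 / (4 * n)) := by
          field_simp
          norm_num
      _ ≤ 1 * (3 / (4 * n)) := by
          gcongr
          rw [div_le_one (by positivity)]
          have : (2 : ℝ) ^ 5 ≤ n ^ 5 := by gcongr
          linarith
      _ = _ := one_mul _

end Main

end WCluster

theorem lemma2 (k : ℕ) :
    ∃ C : ℝ, 0 < C ∧
      ∀ n : ℕ, 2 ≤ n → ∀ (G : SimpleGraph (Fin n)) (w : Sym2 (Fin n) → ℕ),
        G.Connected → (∀ e ∈ G.edgeSet, 0 < w e ∧ w e ≤ n ^ k) →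
        ∀ τ : ℕ, 1 ≤ τ → τ ≤ n →
          ENNReal.ofReal (1 - 1 / (n : ℝ)) ≤
            WCluster.cluster2Prob G w τ fun asg trace =>
              (∃ (K : ℕ) (c : Fin n → Fin n),
                (∀ v, asg v = (c v : WithTop (Fin n))) ∧
                WCluster.IsClustering K c ∧
                (K : ℝ) ≤ C * τ * Real.logb 2 n ^ 4 ∧
                (WCluster.radius G w c : ℝ) ≤
                  C * WCluster.optRadius G w τ * Real.logb 2 n ^ 2) ∧
              (trace.length : ℝ) ≤
                C * max 1 (WCluster.ell G w (WCluster.optRadius G w τ * Real.logb 2 n) : ℝ) *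
                  Real.logb 2 n ∧
              ∀ Δ ∈ trace, (Δ : ℝ) ≤ C * WCluster.optRadius G w τ * Real.logb 2 n := by
  -- The first summand serves the number of clusters and the second the number of growing steps; the
  -- sum also exceeds the constants 16 for the radius and 8 for the thresholds.
  refine ⟨2688 + 18 * (k + 8), by positivity, ?_⟩
  intro n hn G w hG hwb τ hτ hτn
  set C : ℝ := 2688 + 18 * (k + 8) with hC
  have hk0 : (0 : ℝ) ≤ k := Nat.cast_nonneg k
  have hw : ∀ e ∈ G.edgeSet, 1 ≤ w e := fun e he => (hwb e he).1
  have hcard : Fintype.card (Fin n) = n := Fintype.card_fin n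
  obtain ⟨c, hc, hr⟩ := WCluster.exists_optRadius_eq (G := G) (w := w) hτ (hτn.trans hcard.ge)
  have hn' : (2 : ℝ) ≤ n := by exact_mod_cast hn
  have hτ' : (1 : ℝ) ≤ τ := by exact_mod_cast hτ
  set lg := Real.logb 2 n with hlg
  have hlg1 : 1 ≤ lg := by
    rw [hlg, Real.le_logb_iff_rpow_le one_lt_two (by linarith)]
    simpa using hn'
  set J := Nat.log 2 (Fintype.card (Fin n)) with hJ
  have hJlg : (J : ℝ) ≤ lg := by
    rw [hJ, hcard]
    exact Real.natLog_le_logb _ _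
  set R := WCluster.optRadius G w τ with hR
  set B := 8 * J * WCluster.radius G w c with hB
  have hBR : (B : ℝ) ≤ 8 * (R * lg) := by
    rw [hB, hr]
    push_cast
    nlinarith [mul_le_mul_of_nonneg_right hJlg (Nat.cast_nonneg (α := ℝ) R)]
  set ℓ := WCluster.ell G w (R * lg) with hℓ
  have hellB : WCluster.ell G w B ≤ 8 * (ℓ + 1) :=
    (WCluster.ell_mono hG hBR).trans (by
      simpa using WCluster.ell_mul_le hG hw (by positivity : 0 ≤ (R : ℝ) * lg) 8)
  set L := WCluster.ell G w B + 2 with hL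
  -- `L ≤ 8 (ℓ + 1) + 2 = 8 ℓ + 10`.
  have hLmax : (L : ℝ) ≤ 18 * max 1 (ℓ : ℝ) := by
    have h1 : (L : ℝ) ≤ 8 * (ℓ + 1) + 2 := by exact_mod_cast Nat.add_le_add_right hellB 2
    linarith [le_max_left (1 : ℝ) ℓ, le_max_right (1 : ℝ) ℓ]
  refine WCluster.cluster2Prob_ge (L + B + J + 1) (by positivity) ?_
  have hmain := WCluster.cluster2_compl_le hG hw (hn.trans hcard.ge) hτ hc
    hJ rfl hB hL (N := L + B + J + 1) (by omega) (by omega) (by omega)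
  rw [hcard] at hmain
  refine le_trans (MeasureTheory.measure_mono ?_) hmain
  rw [Set.compl_subset_compl]
  rintro o ⟨asg, tr, rfl, ⟨K, c', hasg, hcl, hK, hrad⟩, ⟨m, hm, hlen⟩, hB'⟩
  refine ⟨asg, tr, rfl, ⟨K, c', hasg, hcl, hK.trans ?_, ?_⟩, ?_, ?_⟩
  · gcongr
    linarith
  · have hrad' : (WCluster.radius G w c' : ℝ) ≤ 16 * J ^ 2 * R := by
      rw [← hr]
      exact_mod_cast hrad
    calc (WCluster.radius G w c' : ℝ) ≤ 16 * J ^ 2 * R := hrad'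
      _ ≤ C * lg ^ 2 * R := by
          gcongr
          linarith
      _ = _ := by ring
  -- The threshold starts at 1 or more and, if doubled at all, ends at most at `B ≤ 8 n · n^{k+1}`,
  -- so `m ≤ 3 + (k + 2) log n`. This is where polynomial weights are needed.
  · have hm' : (m : ℝ) ≤ (k + 5) * lg := by
      have hpow : 2 ^ m ≤ 8 * n * (n * n ^ k) := by
        have hn1 : 1 ≤ n ^ k := Nat.one_le_pow _ _ (by omega)
        rcases hm with rfl | h
        · rw [pow_zero]
          exact Nat.one_le_iff_ne_zero.2 (by positivity)
        · have hΔ : 1 ≤ sInf (w '' G.edgeSet) := by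
            obtain ⟨e, he, hee⟩ := Nat.sInf_mem
              ((WCluster.exists_adj_of_two_le_card hG (hn.trans hcard.ge)).image w)
            rw [← hee]
            exact hw e he
          have hJn : J ≤ n := hcard ▸ Nat.log_le_self 2 _
          have hRn := WCluster.radius_le_card_mul hG (fun e he => (hwb e he).2) c
          rw [hcard] at hRn
          calc 2 ^ m ≤ sInf (w '' G.edgeSet) * 2 ^ m := Nat.le_mul_of_pos_left _ hΔ
            _ ≤ B := h
            _ ≤ 8 * n * (n * n ^ k) := by
                rw [hB]
                gcongr
      have hpow' : (2 : ℝ) ^ m ≤ 2 ^ 3 * n ^ (k + 2) := by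
        have : (2 : ℝ) ^ m ≤ 8 * n * (n * n ^ k) := by exact_mod_cast hpow
        exact this.trans_eq (by ring)
      have hlog := Real.logb_le_logb_of_le one_lt_two (by positivity) hpow'
      rw [Real.logb_mul (by positivity) (by positivity), Real.logb_pow, Real.logb_pow,
        Real.logb_pow, Real.logb_self_eq_one one_lt_two, ← hlg] at hlog
      push_cast at hlog
      linarith
    calc (tr.length : ℝ) ≤ (3 * J + m) * L := by exact_mod_cast hlen
      _ ≤ (3 * lg + (k + 5) * lg) * (18 * max 1 (ℓ : ℝ)) := by gcongr
      _ = (18 * (k + 8)) * max 1 (ℓ : ℝ) * lg := by ring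
      _ ≤ C * max 1 (ℓ : ℝ) * lg := by
          gcongr
          linarith
  · intro x hx
    have hxB : (x : ℝ) ≤ B := by exact_mod_cast hB' x hx
    calc (x : ℝ) ≤ 8 * (R * lg) := hxB.trans hBR
      _ ≤ C * (R * lg) := by
          gcongr
          linarith
      _ = _ := by ring
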